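/- Let $T\in\mathbb{N}$, $\mathcal{T}=\{1,\dots,T\}$, and let $(D,Z)$ be a random pair with $D\in\mathcal{T}$, $Z$ real-valued and $\operatorname{E}[Z^2]<\infty$. For each $j\in\mathcal{T}$ let $(D_{j,k},Z_{j,k})_{k\ge1}$ be an i.i.d. sequence with $(D_{j,k},Z_{j,k})\stackrel{d}{=}(D,Z)$, let $\lambda_j\in(0,\infty)$, and let $(Y_{j,k})_{k\ge1}$ be an i.i.d. sequence of almost surely nonnegative random variables with $\operatorname{E}[Y_{j,k}]=1/\lambda_j$ and $\operatorname{var}(Y_{j,k})<\infty$; write $\operatorname{var}(Y_j)$ for this common variance. For $\alpha\ge0$ let $$M_j^\alpha=\sup\Big\{m\ge1:\ \sum_{k=1}^m Y_{j,k}\le\alpha\Big\}\qquad(\sup\emptyset=0)$$ be the renewal counting process with inter-arrival times $Y_{j,k}$, and suppose that, for each $j$ and each $\alpha\ge 0$, the variable $M_j^\alpha$ is independent of the sequence $(D_{j,k},Z_{j,k})_{k\ge1}$. For $j\in\mathcal{T}$ put $$S_j^\alpha=\sum_{k=1}^{M_j^\alpha}Z_{j,k}\big(1\{D_{j,k}=1\},\dots,1\{D_{j,k}=T\}\big).$$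 Then, for every $j\in\mathcal{T}$, $S_j^\alpha$ is integrable for every $\alpha\ge0$, the matrix $\Sigma=\Sigma^{(j)}$ with entries $$\Sigma_{s,t}=\lambda_j\operatorname{E}\big[Z^2 1\{D=s\}1\{D=t\}\big]+\lambda_j\big(\lambda_j^2\operatorname{var}(Y_j)-1\big)\operatorname{E}\big[Z1\{D=s\}\big]\operatorname{E}\big[Z1\{D=t\}\big],\qquad s,t\in\mathcal{T},$$ is positive semidefinite, and $$\alpha^{-1/2}\big(S_j^\alpha-\operatorname{E}[S_j^\alpha]\big)\stackrel{d}{\to}\operatorname{N}_T(0,\Sigma)\qquad\text{as }\alpha\to\infty.$$ -/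

import Mathlib

open MeasureTheory ProbabilityTheory Filter Topology

noncomputable section

namespace ChainLadder

/-- The real-valued indicator `1{d = t}` of the event that the development year `d` is `t`. -/
def ind {T : ℕ} (d t : Fin T) : ℝ := if d = t then 1 else 0

/-- The renewal counting variable `M^α = sup {m ≥ 1 : Y_1 + ⋯ + Y_m ≤ α}`, where the `k`-th
inter-arrival time is `Y (k - 1)`. The supremum of the empty set is `0`; the set is unbounded only
on a null set when the inter-arrival times are i.i.d., nonnegative, with positive mean. -/
def renewalCount {Ω : Type*} (Y : ℕ → Ω → ℝ) (α : ℝ) (ω : Ω) : ℕ :=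
  sSup {m : ℕ | 1 ≤ m ∧ ∑ k ∈ Finset.range m, Y k ω ≤ α}

/-- The vector compound sum `∑_{k ≤ M} Z_k (1{D_k = 1}, …, 1{D_k = T})`, with the development years
`1, …, T` represented by `Fin T` and the `k`-th claim by index `k - 1`. -/
def compoundSum {Ω : Type*} {T : ℕ} (M : Ω → ℕ) (D : ℕ → Ω → Fin T) (Z : ℕ → Ω → ℝ) (ω : Ω) :
    EuclideanSpace ℝ (Fin T) :=
  ∑ k ∈ Finset.range (M ω), Z k ω • WithLp.toLp 2 (fun t => ind (D k ω) t)

/-- The matrix with entries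
`λ E[Z² 1{D = s} 1{D = t}] + λ (λ² v - 1) E[Z 1{D = s}] E[Z 1{D = t}]`. -/
def limitCov {Ω' : Type*} [MeasurableSpace Ω'] {T : ℕ} (P : Measure Ω') (D : Ω' → Fin T)
    (Z : Ω' → ℝ) (lam v : ℝ) : Matrix (Fin T) (Fin T) ℝ :=
  Matrix.of fun s t =>
    lam * (∫ ω, Z ω ^ 2 * ind (D ω) s * ind (D ω) t ∂P)
      + lam * (lam ^ 2 * v - 1) * (∫ ω, Z ω * ind (D ω) s ∂P) * (∫ ω, Z ω * ind (D ω) t ∂P)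

end ChainLadder

end

/-!
Write `N = M + 1` for the index of the first renewal epoch beyond `α`, `m = 1 / λ` for the mean
inter-arrival time, `C_n` for the sum of the first `n` centered inter-arrival times, `x̄` for the
mean claim vector, and `n = ⌊λ α⌋`.

The event that the `k`-th epoch is at most `α` depends on `Y 0, …, Y (k - 1)` only, so sums up to
`N` are predictable sums. Wald's identity (`IsRenewalSequence.wald`) gives the mean overshoot
`r = m E N - α ≥ 0`, and its version for truncated inter-arrival times gives
`r ≤ c + E N * E (Y - c)⁺` for every level `c`. With `c = ε √α` and `E Y² < ∞` this shows
`r = o(√α)` (`IsRenewalSequence.tendsto_excess_div_sqrt`), which is what centering at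
`E S = E M • x̄` requires. Orthogonality of martingale differences gives
`E |C_N - C_n| ≤ √(var Y * E |N - n|)` (`IsRenewalSequence.integral_abs_sum_sub_sum_le`). Since
`N - λ α` is `λ` times the overshoot minus `λ C_N`, taking first `n = 0` and then `n = ⌊λ α⌋` yields
`E |N - n| = O(√α)` and `E |M - E M + λ C_n| = o(√α)`. No maximal inequality and no
distribution functions are needed.

For the limit law, project the claim vectors to the real line and condition on `M`. The
characteristic function of the scaled sum becomes `E [φ ^ M * exp (i s b (M - E M))]`, where
`s = 1 / √α`, `b` is the mean of the projected claim and `φ = 1 + O(1 / α)` is the characteristic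
function of the centered projected claim at `s`. The two `L¹` estimates above allow `M` to be
replaced by `n` in the power and `M - E M` by `-λ C_n` in the exponential
(`IsRenewalSequence.tendsto_integral_exp_compound`), so the limit is the product of those of two
one-dimensional central limit theorems. Up to the factor `-1 / 2` its exponent is the quadratic form
of the limiting matrix, written as a sum of nonnegative terms, a variance and a square
(`dotProduct_limitCov_mulVec`); hence the matrix is positive semidefinite, and Lévy's continuity
theorem concludes.
-/

namespace ChainLadder

/-! ### Predictable sums of independent variables -/

/-- The σ-algebra generated by `Y 0, …, Y (k - 1)`. -/
abbrev past {Ω : Type*} (Y : ℕ → Ω → ℝ) (k : ℕ) : MeasurableSpace Ω :=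
  ⨆ i ∈ Set.Iio k, MeasurableSpace.comap (Y i) inferInstance

lemma past_mono {Ω : Type*} {Y : ℕ → Ω → ℝ} {k l : ℕ} (h : k ≤ l) : past Y k ≤ past Y l :=
  biSup_mono fun _ hi => lt_of_lt_of_le hi h

lemma measurable_past_of_lt {Ω : Type*} {Y : ℕ → Ω → ℝ} {i k : ℕ} (h : i < k) :
    Measurable[past Y k] (Y i) :=
  measurable_iff_comap_le.2 (le_iSup₂_of_le i h le_rfl)

lemma measurable_past_sum_range {Ω : Type*} {Y : ℕ → Ω → ℝ} (k : ℕ) :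
    Measurable[past Y k] fun ω => ∑ i ∈ Finset.range k, Y i ω :=
  Finset.measurable_fun_sum _ fun _ hi => measurable_past_of_lt (Finset.mem_range.1 hi)

section

variable {Ω : Type*} [mΩ : MeasurableSpace Ω] {μ : Measure Ω} {Y : ℕ → Ω → ℝ}

lemma past_le (hY : ∀ k, Measurable (Y k)) (k : ℕ) : past Y k ≤ mΩ :=
  iSup₂_le fun i _ => (hY i).comap_le

lemma indepFun_of_measurable_past (hY : ∀ k, Measurable (Y k)) (hind : iIndepFun Y μ) {k : ℕ}
    {H : Ω → ℝ} (hH : Measurable[past Y k] H) : IndepFun H (Y k) μ := by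
  have h := indep_iSup_of_disjoint (fun i => (hY i).comap_le) hind.iIndep
    (S := Set.Iio k) (T := {k}) (by simp)
  rw [IndepFun_iff_Indep]
  refine indep_of_indep_of_le_left (indep_of_indep_of_le_right h ?_) hH.comap_le
  exact le_iSup₂_of_le k rfl le_rfl

lemma integrable_mul_of_measurable_past (hY : ∀ k, Measurable (Y k)) (hind : iIndepFun Y μ)
    {k : ℕ} {H : Ω → ℝ} (hH : Measurable[past Y k] H) (hHi : Integrable H μ)
    {g : ℝ → ℝ} (hg : Measurable g) (hgi : Integrable (fun ω => g (Y k ω)) μ) :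
    Integrable (fun ω => H ω * g (Y k ω)) μ :=
  ((indepFun_of_measurable_past hY hind hH).comp measurable_id hg).integrable_mul hHi hgi

lemma integral_mul_of_measurable_past (hY : ∀ k, Measurable (Y k)) (hind : iIndepFun Y μ)
    {k : ℕ} {H : Ω → ℝ} (hH : Measurable[past Y k] H) {g : ℝ → ℝ} (hg : Measurable g) :
    ∫ ω, H ω * g (Y k ω) ∂μ = (∫ ω, H ω ∂μ) * ∫ ω, g (Y k ω) ∂μ :=
  ((indepFun_of_measurable_past hY hind hH).comp measurable_id hg).integral_fun_mul_eq_mul_integral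
    (hH.mono (past_le hY k) le_rfl).aestronglyMeasurable (hg.comp (hY k)).aestronglyMeasurable

/-- Orthogonality of martingale differences: if every `h k` is bounded and depends only on
`Y 0, …, Y (k - 1)`, and the `g (Y k)` are centered with second moment `v`, then
`E (∑ h k * g (Y k))² = v * ∑ E (h k)²`. -/
lemma integral_sq_sum_mul_of_measurable_past [IsProbabilityMeasure μ]
    (hY : ∀ k, Measurable (Y k)) (hind : iIndepFun Y μ)
    {h : ℕ → Ω → ℝ} (hh : ∀ k, Measurable[past Y k] (h k)) (hb : ∀ k ω, |h k ω| ≤ 1)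
    {g : ℝ → ℝ} (hg : Measurable g) (hg2 : ∀ k, MemLp (fun ω => g (Y k ω)) 2 μ)
    (hg0 : ∀ k, ∫ ω, g (Y k ω) ∂μ = 0) {v : ℝ} (hv : ∀ k, ∫ ω, g (Y k ω) ^ 2 ∂μ = v) (K : ℕ) :
    MemLp (fun ω => ∑ k ∈ Finset.range K, h k ω * g (Y k ω)) 2 μ ∧
    ∫ ω, (∑ k ∈ Finset.range K, h k ω * g (Y k ω)) ^ 2 ∂μ
      = v * ∑ k ∈ Finset.range K, ∫ ω, h k ω ^ 2 ∂μ := by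
  have hhm : ∀ k, Measurable (h k) := fun k => (hh k).mono (past_le hY k) le_rfl
  have hmul : ∀ {F : Ω → ℝ} (k : ℕ), MemLp F 2 μ → MemLp (fun ω => h k ω * F ω) 2 μ := by
    intro F k hF
    refine hF.mono ((hhm k).aestronglyMeasurable.mul hF.1) (ae_of_all _ fun ω => ?_)
    rw [norm_mul]
    exact mul_le_of_le_one_left (norm_nonneg _) (hb k ω)
  induction K with
  | zero => simp
  | succ K ih =>
    obtain ⟨hL, hE⟩ := ih
    set G : Ω → ℝ := fun ω => ∑ k ∈ Finset.range K, h k ω * g (Y k ω) with hG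
    have hGp : Measurable[past Y K] G := by
      refine Finset.measurable_fun_sum _ fun k hk => ?_
      have hk := Finset.mem_range.1 hk
      exact ((hh k).mono (past_mono hk.le) le_rfl).mul (hg.comp (measurable_past_of_lt hk))
    have hsum : ∀ ω, ∑ k ∈ Finset.range (K + 1), h k ω * g (Y k ω)
        = G ω + h K ω * g (Y K ω) := fun ω => Finset.sum_range_succ _ _
    have hlast := hmul K (hg2 K)
    simp_rw [hsum]
    refine ⟨hL.add hlast, ?_⟩
    have e : ∀ ω, (G ω + h K ω * g (Y K ω)) ^ 2
        = G ω ^ 2 + 2 * ((h K ω * G ω) * g (Y K ω)) + h K ω ^ 2 * g (Y K ω) ^ 2 := by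
      intro ω; ring
    simp_rw [e]
    have i1 : Integrable (fun ω => G ω ^ 2) μ := hL.integrable_sq
    have i2 : Integrable (fun ω => 2 * ((h K ω * G ω) * g (Y K ω))) μ := by
      refine (MemLp.integrable_mul (hmul K hL) (hg2 K)).const_mul 2
    have i3 : Integrable (fun ω => h K ω ^ 2 * g (Y K ω) ^ 2) μ := by
      simpa only [mul_pow] using hlast.integrable_sq
    have i12 : Integrable (fun ω => G ω ^ 2 + 2 * ((h K ω * G ω) * g (Y K ω))) μ := i1.add i2
    rw [integral_add i12 i3, integral_add i1 i2, integral_const_mul,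
      integral_mul_of_measurable_past hY hind (H := fun ω => h K ω * G ω) ((hh K).mul hGp) hg,
      integral_mul_of_measurable_past hY hind (H := fun ω => h K ω ^ 2) ((hh K).pow_const 2)
        (hg.pow_const 2), hg0, hv, hE, Finset.sum_range_succ]
    ring

/-- Jensen: `E |f| ≤ √(E f²)`. -/
lemma integral_abs_le_sqrt [IsProbabilityMeasure μ] {f : Ω → ℝ} (hf : MemLp f 2 μ) :
    ∫ ω, |f ω| ∂μ ≤ √(∫ ω, f ω ^ 2 ∂μ) := by
  apply Real.le_sqrt_of_sq_le
  have h := variance_nonneg |f| μ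
  rw [variance_eq_sub hf.abs] at h
  simp only [Pi.pow_apply, Pi.abs_apply, sq_abs] at h
  linarith

/-- Fatou's lemma in `L¹`: bounds on `E |f n|` pass to almost sure limits. -/
lemma integrable_and_integral_abs_le_of_tendsto {f : ℕ → Ω → ℝ} {F : Ω → ℝ} {B : ℝ}
    (hf : ∀ n, Integrable (f n) μ) (hB : ∀ n, ∫ ω, |f n ω| ∂μ ≤ B)
    (hlim : ∀ᵐ ω ∂μ, Tendsto (fun n => f n ω) atTop (𝓝 (F ω))) :
    Integrable F μ ∧ ∫ ω, |F ω| ∂μ ≤ B := by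
  have hB0 : 0 ≤ B := (integral_nonneg fun _ => abs_nonneg _).trans (hB 0)
  have hm : AEStronglyMeasurable F μ :=
    aestronglyMeasurable_of_tendsto_ae atTop (fun n => (hf n).1) hlim
  have key : eLpNorm F 1 μ ≤ ENNReal.ofReal B := by
    refine Lp.eLpNorm_le_of_ae_tendsto (Eventually.of_forall fun n => ?_) (fun n => (hf n).1) hlim
    rw [eLpNorm_one_eq_lintegral_enorm, ← ofReal_integral_norm_eq_lintegral_enorm (hf n)]
    exact ENNReal.ofReal_le_ofReal (hB n)
  have hi : Integrable F μ :=
    memLp_one_iff_integrable.1 ⟨hm, key.trans_lt ENNReal.ofReal_lt_top⟩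
  refine ⟨hi, ?_⟩
  rw [eLpNorm_one_eq_lintegral_enorm, ← ofReal_integral_norm_eq_lintegral_enorm hi,
    ENNReal.ofReal_le_ofReal_iff hB0] at key
  exact key

end

/-! ### The renewal counting variable -/

/-- `Y` is an i.i.d. sequence of almost surely nonnegative, square-integrable inter-arrival times
with positive mean. -/
structure IsRenewalSequence {Ω : Type*} [MeasurableSpace Ω] (μ : Measure Ω) (Y : ℕ → Ω → ℝ) :
    Prop where
  measurable : ∀ k, Measurable (Y k)
  nonneg : ∀ k, ∀ᵐ ω ∂μ, 0 ≤ Y k ω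
  indep : iIndepFun Y μ
  identDistrib : ∀ k, IdentDistrib (Y k) (Y 0) μ μ
  memLp : MemLp (Y 0) 2 μ
  mean_pos : 0 < ∫ ω, Y 0 ω ∂μ

/-- The event that the `k`-th renewal epoch `Y 0 + ⋯ + Y (k - 1)` is at most `α`. -/
def reached {Ω : Type*} (Y : ℕ → Ω → ℝ) (α : ℝ) (k : ℕ) : Set Ω :=
  {ω | ∑ i ∈ Finset.range k, Y i ω ≤ α}

/-- The indicator function of `reached Y α k`. -/
noncomputable def reachedInd {Ω : Type*} (Y : ℕ → Ω → ℝ) (α : ℝ) (k : ℕ) : Ω → ℝ :=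
  (reached Y α k).indicator 1

lemma measurable_past_reachedInd {Ω : Type*} {Y : ℕ → Ω → ℝ} (α : ℝ) (k : ℕ) :
    Measurable[past Y k] (reachedInd Y α k) := by
  let _ : MeasurableSpace Ω := past Y k
  exact measurable_one.indicator (measurableSet_le (measurable_past_sum_range k) measurable_const)

lemma reachedInd_nonneg {Ω : Type*} (Y : ℕ → Ω → ℝ) (α : ℝ) (k : ℕ) (ω : Ω) :
    0 ≤ reachedInd Y α k ω :=
  Set.indicator_nonneg (fun _ _ => zero_le_one) ω

lemma reachedInd_le_one {Ω : Type*} (Y : ℕ → Ω → ℝ) (α : ℝ) (k : ℕ) (ω : Ω) :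
    reachedInd Y α k ω ≤ 1 :=
  Set.indicator_le_self' (fun _ _ => zero_le_one) ω

/-- Pointwise truncated bound: before the first epoch beyond `α`, at most one term
exceeds what is already counted in the partial sum. -/
lemma sum_reachedInd_mul_min_le {Ω : Type*} {Y : ℕ → Ω → ℝ} {α c : ℝ} (hα : 0 ≤ α) (hc : 0 ≤ c)
    {ω : Ω} (hω : ∀ k, 0 ≤ Y k ω) (K : ℕ) :
    ∑ k ∈ Finset.range K, reachedInd Y α k ω * min (Y k ω) c ≤ α + c := by
  -- the induction needs both bounds: the first serves as long as the epochs are at most `α`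
  suffices h : ∑ k ∈ Finset.range K, reachedInd Y α k ω * min (Y k ω) c
      ≤ min (∑ k ∈ Finset.range K, Y k ω) (α + c) from h.trans (min_le_right _ _)
  induction K with
  | zero => simp [add_nonneg hα hc]
  | succ K ih =>
    rw [Finset.sum_range_succ, Finset.sum_range_succ]
    have h1 := ih.trans (min_le_left _ _)
    have h2 := ih.trans (min_le_right _ _)
    have hY := hω K
    by_cases hK : ω ∈ reached Y α K
    · have hα' : ∑ k ∈ Finset.range K, Y k ω ≤ α := hK
      have : reachedInd Y α K ω = 1 := Set.indicator_of_mem hK _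
      rw [this, one_mul]
      have := min_le_left (Y K ω) c
      have := min_le_right (Y K ω) c
      apply le_min <;> linarith
    · have : reachedInd Y α K ω = 0 := Set.indicator_of_notMem hK _
      rw [this, zero_mul, add_zero]
      apply le_min <;> linarith

/-- Once the set of reached epochs is finite, `renewalCount` is its largest element. -/
lemma mem_reached_iff_le_renewalCount {Ω : Type*} {Y : ℕ → Ω → ℝ} {α : ℝ} (hα : 0 ≤ α) {ω : Ω}
    (hω : ∀ k, 0 ≤ Y k ω) (hfin : {k | ω ∈ reached Y α k}.Finite) (k : ℕ) :
    ω ∈ reached Y α k ↔ k ≤ renewalCount Y α ω := by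
  have hanti : ∀ {k l : ℕ}, k ≤ l → ω ∈ reached Y α l → ω ∈ reached Y α k := fun {k l} hkl hl =>
    (Finset.sum_le_sum_of_subset_of_nonneg (Finset.range_subset_range.2 hkl)
      fun i _ _ => hω i).trans hl
  have h0 : ω ∈ reached Y α 0 := by simpa [reached] using hα
  have hbdd : BddAbove {m : ℕ | 1 ≤ m ∧ ∑ i ∈ Finset.range m, Y i ω ≤ α} :=
    (hfin.subset fun m hm => hm.2).bddAbove
  constructor
  · intro hk
    rcases Nat.eq_zero_or_pos k with rfl | hk0
    · exact Nat.zero_le _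
    · exact le_csSup hbdd ⟨hk0, hk⟩
  · intro hk
    refine hanti hk ?_
    rcases Set.eq_empty_or_nonempty {m : ℕ | 1 ≤ m ∧ ∑ i ∈ Finset.range m, Y i ω ≤ α} with h | h
    · rw [renewalCount, h, csSup_empty]
      exact h0
    · exact (Nat.sSup_mem h hbdd).2

/-- Measurable everywhere, including the null set on which the supremum is over an unbounded set
and equals `0`. -/
lemma measurable_renewalCount {Ω : Type*} [MeasurableSpace Ω] {Y : ℕ → Ω → ℝ}
    (hY : ∀ k, Measurable (Y k)) (α : ℝ) : Measurable (renewalCount Y α) := by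
  have hr : ∀ k, MeasurableSet {ω | 1 ≤ k ∧ ∑ i ∈ Finset.range k, Y i ω ≤ α} := fun k =>
    (MeasurableSet.const _).inter
      (measurableSet_le (Finset.measurable_fun_sum _ fun i _ => hY i) measurable_const)
  refine measurable_of_Ici fun m => ?_
  have : renewalCount Y α ⁻¹' Set.Ici m = {_ω | m = 0} ∪
      ((⋃ B : ℕ, ⋂ k : ℕ, ({ω | 1 ≤ k ∧ ∑ i ∈ Finset.range k, Y i ω ≤ α}ᶜ ∪ {_ω | k ≤ B})) ∩
        ⋃ k : ℕ, {_ω | m ≤ k} ∩ {ω | 1 ≤ k ∧ ∑ i ∈ Finset.range k, Y i ω ≤ α}) := by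
    ext ω
    set S := {m : ℕ | 1 ≤ m ∧ ∑ i ∈ Finset.range m, Y i ω ≤ α} with hS
    have e1 : (∃ B : ℕ, ∀ k : ℕ, k ∉ S ∨ k ≤ B) ↔ BddAbove S := by
      simp only [bddAbove_def, ← imp_iff_not_or]
    have e2 : m ≤ sSup S ↔ m = 0 ∨ (BddAbove S ∧ ∃ k, m ≤ k ∧ k ∈ S) := by
      constructor
      · intro h
        rcases Nat.eq_zero_or_pos m with h0 | h0
        · exact Or.inl h0
        · right
          by_cases hb : BddAbove S
          · refine ⟨hb, sSup S, h, Nat.sSup_mem ?_ hb⟩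
            by_contra hne
            rw [Set.not_nonempty_iff_eq_empty.1 hne, csSup_empty] at h
            exact absurd h (by simpa using h0.ne')
          · rw [csSup_of_not_bddAbove hb, csSup_empty] at h
            exact absurd h (by simpa using h0.ne')
      · rintro (rfl | ⟨hb, k, hk, hkS⟩)
        · exact Nat.zero_le _
        · exact hk.trans (le_csSup hb hkS)
    simp only [Set.mem_preimage, Set.mem_Ici, Set.mem_union, Set.mem_inter_iff, Set.mem_iUnion,
      Set.mem_iInter, Set.mem_compl_iff]
    exact e2.trans (or_congr Iff.rfl (and_congr e1.symm Iff.rfl))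
  rw [this]
  refine (MeasurableSet.const _).union (MeasurableSet.inter ?_ ?_)
  · exact .iUnion fun B => .iInter fun k => (hr k).compl.union (.const _)
  · exact .iUnion fun k => (MeasurableSet.const _).inter (hr k)

namespace IsRenewalSequence

variable {Ω : Type*} [MeasurableSpace Ω] {μ : Measure Ω} {Y : ℕ → Ω → ℝ} {α : ℝ}

lemma ae_nonneg (hY : IsRenewalSequence μ Y) : ∀ᵐ ω ∂μ, ∀ k, 0 ≤ Y k ω :=
  ae_all_iff.2 hY.nonneg

lemma measurableSet_reached (hY : IsRenewalSequence μ Y) (α : ℝ) (k : ℕ) :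
    MeasurableSet (reached Y α k) :=
  measurableSet_le (Finset.measurable_fun_sum _ fun i _ => hY.measurable i) measurable_const

lemma integral_eq (hY : IsRenewalSequence μ Y) {g : ℝ → ℝ} (hg : Measurable g) (k : ℕ) :
    ∫ ω, g (Y k ω) ∂μ = ∫ ω, g (Y 0 ω) ∂μ :=
  ((hY.identDistrib k).comp hg).integral_eq

lemma integral_reachedInd (hY : IsRenewalSequence μ Y) (α : ℝ) (k : ℕ) :
    ∫ ω, reachedInd Y α k ω ∂μ = μ.real (reached Y α k) :=
  integral_indicator_one (hY.measurableSet_reached α k)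

variable [IsProbabilityMeasure μ]

lemma integrable_reachedInd (hY : IsRenewalSequence μ Y) (α : ℝ) (k : ℕ) :
    Integrable (reachedInd Y α k) μ :=
  (integrable_const (1 : ℝ)).indicator (hY.measurableSet_reached α k)

lemma integrable (hY : IsRenewalSequence μ Y) (k : ℕ) : Integrable (Y k) μ :=
  (hY.identDistrib k).integrable_iff.2 (hY.memLp.integrable one_le_two)

lemma sum_measureReal_reached_mul_le (hY : IsRenewalSequence μ Y) (hα : 0 ≤ α) {c : ℝ}
    (hc : 0 ≤ c) (K : ℕ) :
    (∑ k ∈ Finset.range K, μ.real (reached Y α k)) * ∫ ω, min (Y 0 ω) c ∂μ ≤ α + c := by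
  have hm : Measurable fun y : ℝ => min y c := measurable_id.min measurable_const
  have hi : ∀ k, Integrable (fun ω => min (Y k ω) c) μ := fun k =>
    (hY.integrable k).inf (integrable_const c)
  have hi' : ∀ k, Integrable (fun ω => reachedInd Y α k ω * min (Y k ω) c) μ := fun k =>
    integrable_mul_of_measurable_past hY.measurable hY.indep (measurable_past_reachedInd α k)
      (hY.integrable_reachedInd α k) hm (hi k)
  calc (∑ k ∈ Finset.range K, μ.real (reached Y α k)) * ∫ ω, min (Y 0 ω) c ∂μ
      = ∫ ω, ∑ k ∈ Finset.range K, reachedInd Y α k ω * min (Y k ω) c ∂μ := by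
        rw [integral_finsetSum _ fun k _ => hi' k, Finset.sum_mul]
        refine Finset.sum_congr rfl fun k _ => ?_
        rw [integral_mul_of_measurable_past hY.measurable hY.indep
          (measurable_past_reachedInd α k) hm, hY.integral_reachedInd,
          hY.integral_eq (g := fun y => min y c) hm k]
    _ ≤ ∫ _, α + c ∂μ := by
        refine integral_mono_ae (integrable_finsetSum _ fun k _ => hi' k) (integrable_const _) ?_
        filter_upwards [hY.ae_nonneg] with ω hω
        exact sum_reachedInd_mul_min_le hα hc hω K
    _ = α + c := by simp

lemma integral_min_pos (hY : IsRenewalSequence μ Y) {c : ℝ} (hc : 0 < c) :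
    0 < ∫ ω, min (Y 0 ω) c ∂μ := by
  have hnn : 0 ≤ᵐ[μ] fun ω => min (Y 0 ω) c := by
    filter_upwards [hY.nonneg 0] with ω hω using le_min hω hc.le
  refine lt_of_le_of_ne (integral_nonneg_of_ae hnn) fun h => ?_
  have h0 := (integral_eq_zero_iff_of_nonneg_ae hnn
    ((hY.integrable 0).inf (integrable_const c))).1 h.symm
  have : ∫ ω, Y 0 ω ∂μ = 0 := by
    refine integral_eq_zero_of_ae ?_
    filter_upwards [h0] with ω hω
    rcases min_choice (Y 0 ω) c with h | h
    · exact h.symm.trans hω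
    · exact absurd (h.symm.trans hω) hc.ne'
  exact hY.mean_pos.ne' this

/-- The expected number of epochs up to `α` is finite. -/
lemma summable_measureReal_reached (hY : IsRenewalSequence μ Y) (hα : 0 ≤ α) :
    Summable fun k => μ.real (reached Y α k) := by
  have hp := hY.integral_min_pos one_pos
  refine summable_of_sum_range_le (c := (α + 1) / ∫ ω, min (Y 0 ω) 1 ∂μ)
    (fun _ => measureReal_nonneg) fun K => ?_
  rw [le_div_iff₀ hp]
  exact hY.sum_measureReal_reached_mul_le hα zero_le_one K

lemma ae_mem_reached_iff (hY : IsRenewalSequence μ Y) (hα : 0 ≤ α) :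
    ∀ᵐ ω ∂μ, ∀ k, ω ∈ reached Y α k ↔ k ≤ renewalCount Y α ω := by
  have hsum : ∑' k, μ (reached Y α k) ≠ ⊤ := by
    have h := (hY.summable_measureReal_reached hα).tsum_ofReal_ne_top
    simpa [measureReal_def] using h
  filter_upwards [hY.ae_nonneg, ae_finite_setOfPred_mem hsum] with ω h1 h2 k
  exact mem_reached_iff_le_renewalCount hα h1 h2 k

lemma ae_reachedInd_eq (hY : IsRenewalSequence μ Y) (hα : 0 ≤ α) :
    ∀ᵐ ω ∂μ, ∀ k, reachedInd Y α k ω = if k < renewalCount Y α ω + 1 then 1 else 0 := by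
  filter_upwards [hY.ae_mem_reached_iff hα] with ω hω k
  by_cases h : ω ∈ reached Y α k
  · rw [if_pos (Nat.lt_succ_iff.2 ((hω k).1 h))]
    exact Set.indicator_of_mem h _
  · rw [if_neg (fun h' => h ((hω k).2 (Nat.lt_succ_iff.1 h')))]
    exact Set.indicator_of_notMem h _

/-- A sum of reached terms is eventually constant, equal to the sum stopped at the first epoch
beyond `α`. -/
lemma ae_tendsto_sum_reachedInd_mul (hY : IsRenewalSequence μ Y) (hα : 0 ≤ α) (f : ℕ → Ω → ℝ) :
    ∀ᵐ ω ∂μ, Tendsto (fun K => ∑ k ∈ Finset.range K, reachedInd Y α k ω * f k ω) atTop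
      (𝓝 (∑ k ∈ Finset.range (renewalCount Y α ω + 1), f k ω)) := by
  filter_upwards [hY.ae_reachedInd_eq hα] with ω hω
  refine tendsto_const_nhds.congr' ?_
  filter_upwards [eventually_ge_atTop (renewalCount Y α ω + 1)] with K hK
  simp only [hω, ite_mul, one_mul, zero_mul]
  rw [← Finset.sum_filter]
  refine Finset.sum_congr ?_ fun _ _ => rfl
  ext k
  simp only [Finset.mem_filter, Finset.mem_range]
  omega

/-- Wald's identity for the number `renewalCount + 1` of epochs up to the first one beyond `α`. -/
lemma wald (hY : IsRenewalSequence μ Y) (hα : 0 ≤ α) {g : ℝ → ℝ} (hg : Measurable g)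
    (hgi : ∀ k, Integrable (fun ω => g (Y k ω)) μ) :
    Integrable (fun ω => ∑ k ∈ Finset.range (renewalCount Y α ω + 1), g (Y k ω)) μ ∧
    ∫ ω, ∑ k ∈ Finset.range (renewalCount Y α ω + 1), g (Y k ω) ∂μ
      = (∑' k, μ.real (reached Y α k)) * ∫ ω, g (Y 0 ω) ∂μ := by
  have hi : ∀ k, Integrable (fun ω => reachedInd Y α k ω * g (Y k ω)) μ := fun k =>
    integrable_mul_of_measurable_past hY.measurable hY.indep (measurable_past_reachedInd α k)
      (hY.integrable_reachedInd α k) hg (hgi k)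
  have hE : ∀ k, ∫ ω, ‖reachedInd Y α k ω * g (Y k ω)‖ ∂μ
      = μ.real (reached Y α k) * ∫ ω, |g (Y 0 ω)| ∂μ := fun k => by
    have habs : Measurable fun y => |g y| := measurable_norm.comp hg
    simp_rw [Real.norm_eq_abs, abs_mul, abs_of_nonneg (reachedInd_nonneg Y α k _)]
    rw [integral_mul_of_measurable_past hY.measurable hY.indep (measurable_past_reachedInd α k)
      habs, hY.integral_reachedInd, hY.integral_eq (g := fun y => |g y|) habs]
  have hsum := hY.summable_measureReal_reached hα
  have hsumE : Summable fun k => ∫ ω, ‖reachedInd Y α k ω * g (Y k ω)‖ ∂μ := by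
    simpa only [hE] using hsum.mul_right _
  have hlim := hY.ae_tendsto_sum_reachedInd_mul hα fun k ω => g (Y k ω)
  constructor
  · refine (integrable_and_integral_abs_le_of_tendsto
      (fun K => integrable_finsetSum (Finset.range K) fun k _ => hi k)
      (B := ∑' k, ∫ ω, ‖reachedInd Y α k ω * g (Y k ω)‖ ∂μ) (fun K => ?_) hlim).1
    calc ∫ ω, |∑ k ∈ Finset.range K, reachedInd Y α k ω * g (Y k ω)| ∂μ
        ≤ ∫ ω, ∑ k ∈ Finset.range K, ‖reachedInd Y α k ω * g (Y k ω)‖ ∂μ :=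
          integral_mono (integrable_finsetSum _ fun k _ => hi k).abs
            (integrable_finsetSum _ fun k _ => (hi k).norm) fun ω => Finset.abs_sum_le_sum_abs _ _
      _ = ∑ k ∈ Finset.range K, ∫ ω, ‖reachedInd Y α k ω * g (Y k ω)‖ ∂μ :=
          integral_finsetSum _ fun k _ => (hi k).norm
      _ ≤ _ := hsumE.sum_le_tsum _ fun k _ => integral_nonneg fun _ => norm_nonneg _
  · have h1 := (hasSum_integral_of_summable_integral_norm hi hsumE)
    have h2 : ∀ k, ∫ ω, reachedInd Y α k ω * g (Y k ω) ∂μ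
        = μ.real (reached Y α k) * ∫ ω, g (Y 0 ω) ∂μ := fun k => by
      rw [integral_mul_of_measurable_past hY.measurable hY.indep (measurable_past_reachedInd α k)
        hg, hY.integral_reachedInd, hY.integral_eq hg]
    simp only [h2] at h1
    rw [(hsum.hasSum.mul_right _).unique h1]
    refine integral_congr_ae ?_
    filter_upwards [hY.ae_reachedInd_eq hα] with ω hω
    rw [tsum_eq_sum (s := Finset.range (renewalCount Y α ω + 1))]
    · refine Finset.sum_congr rfl fun k hk => ?_
      rw [hω k, if_pos (Finset.mem_range.1 hk), one_mul]
    · intro k hk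
      rw [hω k, if_neg (by simpa using hk), zero_mul]

lemma integrable_renewalCount (hY : IsRenewalSequence μ Y) (hα : 0 ≤ α) :
    Integrable (fun ω => (renewalCount Y α ω : ℝ)) μ := by
  have h := (hY.wald hα (g := fun _ => 1) measurable_const fun _ => integrable_const _).1
  simp only [Finset.sum_const, Finset.card_range, nsmul_eq_mul, mul_one, Nat.cast_add,
    Nat.cast_one] at h
  exact (integrable_add_iff_integrable_left (integrable_const (1 : ℝ))).1 h

lemma integral_renewalCount_add_one (hY : IsRenewalSequence μ Y) (hα : 0 ≤ α) :
    ∫ ω, (renewalCount Y α ω : ℝ) ∂μ + 1 = ∑' k, μ.real (reached Y α k) := by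
  have h := (hY.wald hα (g := fun _ => 1) measurable_const fun _ => integrable_const _).2
  simp only [Finset.sum_const, Finset.card_range, nsmul_eq_mul, mul_one, Nat.cast_add,
    Nat.cast_one] at h
  rw [integral_add (hY.integrable_renewalCount hα) (integrable_const _)] at h
  simpa using h

/-- Wald's identity for inter-arrival times truncated at `c`, whose overshoot is at most `c`. -/
lemma integral_renewalCount_add_one_mul_le (hY : IsRenewalSequence μ Y) (hα : 0 ≤ α) {c : ℝ}
    (hc : 0 ≤ c) :
    (∫ ω, (renewalCount Y α ω : ℝ) ∂μ + 1) * ∫ ω, min (Y 0 ω) c ∂μ ≤ α + c := by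
  rw [hY.integral_renewalCount_add_one hα, ← tsum_mul_right]
  refine ((hY.summable_measureReal_reached hα).mul_right _).tsum_le_of_sum_range_le fun K => ?_
  rw [← Finset.sum_mul]
  exact hY.sum_measureReal_reached_mul_le hα hc K

end IsRenewalSequence

/-! ### Mean and fluctuations of the renewal counting variable -/

/-- The indicators of `[0, a)` and `[0, b)` differ at `|a - b|` indices. -/
lemma sum_sq_indicator_sub_indicator_le (a b K : ℕ) :
    ∑ k ∈ Finset.range K, ((if k < a then (1 : ℝ) else 0) - if k < b then 1 else 0) ^ 2
      ≤ |(a : ℝ) - b| := by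
  wlog hab : b ≤ a generalizing a b
  · rw [abs_sub_comm]
    refine le_of_eq_of_le (Finset.sum_congr rfl fun k _ => ?_) (this b a (le_of_not_ge hab))
    ring
  have h1 : ∀ c : ℕ, ∑ k ∈ Finset.range K, (if k < c then (1 : ℝ) else 0) = (min K c : ℕ) := by
    intro c
    rw [← Finset.sum_filter, Finset.sum_const, nsmul_eq_mul, mul_one,
      show (Finset.range K).filter (· < c) = Finset.range (min K c) by ext; simp,
      Finset.card_range]
  have h2 : ∀ k, ((if k < a then (1 : ℝ) else 0) - if k < b then 1 else 0) ^ 2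
      = (if k < a then (1 : ℝ) else 0) - if k < b then 1 else 0 := by
    intro k
    split_ifs <;> first | (exfalso; omega) | norm_num
  simp_rw [h2]
  rw [Finset.sum_sub_distrib, h1, h1, abs_of_nonneg (by rw [sub_nonneg]; exact_mod_cast hab)]
  have : min K a + b ≤ a + min K b := by omega
  have : ((min K a + b : ℕ) : ℝ) ≤ (a + min K b : ℕ) := by exact_mod_cast this
  push_cast at this ⊢
  linarith

namespace IsRenewalSequence

variable {Ω : Type*} [MeasurableSpace Ω] {μ : Measure Ω} {Y : ℕ → Ω → ℝ} {α : ℝ}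
  [IsProbabilityMeasure μ]

/-- The mean overshoot of the first epoch beyond `α`, from Wald's identity. -/
lemma integral_overshoot (hY : IsRenewalSequence μ Y) (hα : 0 ≤ α) :
    Integrable (fun ω => ∑ k ∈ Finset.range (renewalCount Y α ω + 1), Y k ω - α) μ ∧
    ∫ ω, |∑ k ∈ Finset.range (renewalCount Y α ω + 1), Y k ω - α| ∂μ
      = (∫ ω, (renewalCount Y α ω : ℝ) ∂μ + 1) * ∫ ω, Y 0 ω ∂μ - α := by
  obtain ⟨hi, hE⟩ := hY.wald hα measurable_id fun k => hY.integrable k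
  simp only [id] at hi hE
  refine ⟨hi.sub (integrable_const α), ?_⟩
  rw [hY.integral_renewalCount_add_one hα, ← hE]
  have : ∫ ω, |∑ k ∈ Finset.range (renewalCount Y α ω + 1), Y k ω - α| ∂μ
      = ∫ ω, (∑ k ∈ Finset.range (renewalCount Y α ω + 1), Y k ω - α) ∂μ := by
    refine integral_congr_ae ?_
    filter_upwards [hY.ae_mem_reached_iff hα] with ω hω
    refine abs_of_nonneg ?_
    have h : ω ∉ reached Y α (renewalCount Y α ω + 1) := fun h => by
      have := (hω _).1 h
      omega
    exact sub_nonneg.2 (not_le.1 h).le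
  rw [this, integral_sub hi (integrable_const α)]
  simp

lemma excess_nonneg (hY : IsRenewalSequence μ Y) (hα : 0 ≤ α) :
    0 ≤ (∫ ω, (renewalCount Y α ω : ℝ) ∂μ + 1) * ∫ ω, Y 0 ω ∂μ - α := by
  rw [← (hY.integral_overshoot hα).2]
  exact integral_nonneg fun _ => abs_nonneg _

/-- Finite second moment makes the truncation error `E (Y - c)⁺` of the mean `o(1 / c)`, since
`c (y - c)⁺ ≤ y²`. -/
lemma tendsto_mul_integral_sub_min (hY : IsRenewalSequence μ Y) :
    Tendsto (fun c : ℝ => c * (∫ ω, Y 0 ω ∂μ - ∫ ω, min (Y 0 ω) c ∂μ)) atTop (𝓝 0) := by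
  have e : ∀ c : ℝ, c * (∫ ω, Y 0 ω ∂μ - ∫ ω, min (Y 0 ω) c ∂μ)
      = ∫ ω, c * (Y 0 ω - min (Y 0 ω) c) ∂μ := fun c => by
    have hmin : Integrable (fun ω => min (Y 0 ω) c) μ :=
      (hY.integrable 0).inf (integrable_const c)
    rw [integral_const_mul, integral_sub (hY.integrable 0) hmin]
  simp_rw [e]
  have h0 : (0 : ℝ) = ∫ ω, (0 : ℝ) ∂μ := by simp
  rw [h0]
  have hm := hY.measurable 0
  refine tendsto_integral_filter_of_dominated_convergence (fun ω => Y 0 ω ^ 2)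
    (Eventually.of_forall fun c => ?_) ?_ hY.memLp.integrable_sq ?_
  · exact (measurable_const.mul (hm.sub (hm.min measurable_const))).aestronglyMeasurable
  · filter_upwards [eventually_ge_atTop 0] with c hc
    filter_upwards [hY.nonneg 0] with ω hω
    have h1 := min_le_left (Y 0 ω) c
    rw [Real.norm_eq_abs, abs_of_nonneg (mul_nonneg hc (sub_nonneg.2 h1))]
    rcases le_total (Y 0 ω) c with h | h
    · rw [min_eq_left h]
      nlinarith
    · rw [min_eq_right h]
      nlinarith
  · refine ae_of_all _ fun ω => tendsto_const_nhds.congr' ?_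
    filter_upwards [eventually_ge_atTop (Y 0 ω)] with c hc
    rw [min_eq_left hc, sub_self, mul_zero]

/-- The elementary renewal theorem with error `o(√α)`. Truncating the inter-arrival times at level
`ε √α` bounds the mean overshoot by `ε √α` plus a tail term that is negligible because the second
moment is finite. -/
lemma tendsto_excess_div_sqrt (hY : IsRenewalSequence μ Y) :
    Tendsto (fun α : ℝ =>
      ((∫ ω, (renewalCount Y α ω : ℝ) ∂μ + 1) * ∫ ω, Y 0 ω ∂μ - α) / √α) atTop (𝓝 0) := by
  set q := ∫ ω, min (Y 0 ω) 1 ∂μ with hq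
  have hq0 : 0 < q := hY.integral_min_pos one_pos
  rw [Metric.tendsto_nhds]
  intro ε hε
  have hε2 : 0 < ε / 2 := by positivity
  have hc : Tendsto (fun α : ℝ => ε / 2 * √α) atTop atTop :=
    Real.tendsto_sqrt_atTop.const_mul_atTop hε2
  -- `E N ≤ (2 / q) α` turns the tail term into `(2 / q) / (ε / 2) * (c * E (Y - c)⁺) * √α`
  have hsmall : 0 < ε / 2 / (2 / q / (ε / 2)) := by positivity
  have htail := (hY.tendsto_mul_integral_sub_min.comp hc).eventually (gt_mem_nhds hsmall)
  filter_upwards [htail, eventually_ge_atTop 1] with α h1 hα1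
  have hα : 0 ≤ α := zero_le_one.trans hα1
  have hs : 0 < √α := Real.sqrt_pos.2 (by linarith)
  have hss : √α * √α = α := Real.mul_self_sqrt hα
  simp only [Function.comp] at h1
  set c := ε / 2 * √α with hc'
  have hc0 : 0 < c := by positivity
  set EN := ∫ ω, (renewalCount Y α ω : ℝ) ∂μ + 1 with hEN
  set m := ∫ ω, Y 0 ω ∂μ
  set mc := ∫ ω, min (Y 0 ω) c ∂μ
  have hmc : 0 ≤ m - mc := sub_nonneg.2 (integral_mono
    ((hY.integrable 0).inf (integrable_const c)) (hY.integrable 0) fun ω => min_le_left _ _)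
  have hr := hY.excess_nonneg hα
  have b1 : EN * q ≤ α + 1 := hY.integral_renewalCount_add_one_mul_le hα zero_le_one
  have b2 : EN * mc ≤ α + c := hY.integral_renewalCount_add_one_mul_le hα hc0.le
  have b3 : EN ≤ 2 / q * α := by
    rw [div_mul_eq_mul_div, le_div_iff₀ hq0]
    linarith
  rw [Real.dist_eq, sub_zero, abs_of_nonneg (div_nonneg hr hs.le), div_lt_iff₀ hs]
  have b4 : EN * m - α ≤ c + EN * (m - mc) := by linarith [mul_sub EN m mc]
  have b5 : EN * (m - mc) ≤ 2 / q * α * (m - mc) := mul_le_mul_of_nonneg_right b3 hmc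
  have b6 : 2 / q * α * (m - mc) = 2 / q / (ε / 2) * (c * (m - mc)) * √α := by
    calc 2 / q * α * (m - mc) = 2 / q * (√α * √α) * (m - mc) := by rw [hss]
      _ = _ := by rw [hc']; field_simp
  have b7 : 2 / q / (ε / 2) * (c * (m - mc)) < ε / 2 := by
    rw [lt_div_iff₀ (by positivity)] at h1
    linarith
  calc EN * m - α ≤ c + 2 / q / (ε / 2) * (c * (m - mc)) * √α := by linarith
    _ < c + ε / 2 * √α := by gcongr
    _ = ε * √α := by rw [hc']; ring

/-- The partial sums of the centered inter-arrival times, stopped at the first epoch beyond `α` and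
at a fixed index `n`, differ in mean by at most `√(Var * E |N - n|)`, where
`N = renewalCount + 1`. -/
lemma integral_abs_sum_sub_sum_le (hY : IsRenewalSequence μ Y) (hα : 0 ≤ α) (n : ℕ) :
    Integrable (fun ω =>
      ∑ k ∈ Finset.range (renewalCount Y α ω + 1), (Y k ω - ∫ ω', Y 0 ω' ∂μ)
        - ∑ k ∈ Finset.range n, (Y k ω - ∫ ω', Y 0 ω' ∂μ)) μ ∧
    ∫ ω, |∑ k ∈ Finset.range (renewalCount Y α ω + 1), (Y k ω - ∫ ω', Y 0 ω' ∂μ)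
        - ∑ k ∈ Finset.range n, (Y k ω - ∫ ω', Y 0 ω' ∂μ)| ∂μ
      ≤ √(Var[Y 0; μ] * ∫ ω, |(renewalCount Y α ω : ℝ) + 1 - n| ∂μ) := by
  set m := ∫ ω', Y 0 ω' ∂μ with hm
  -- `∑ h k * (Y k - m)` is the difference of the two stopped sums, and `∑ (h k)²` is `|N - n|`
  let h : ℕ → Ω → ℝ := fun k ω => reachedInd Y α k ω - if k < n then 1 else 0
  have hh : ∀ k, Measurable[past Y k] (h k) := fun k =>
    (measurable_past_reachedInd α k).sub_const _
  have hhm : ∀ k, Measurable (h k) := fun k => (hh k).mono (past_le hY.measurable k) le_rfl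
  have hb : ∀ k ω, |h k ω| ≤ 1 := fun k ω => by
    have h1 := reachedInd_nonneg Y α k ω
    have h2 := reachedInd_le_one Y α k ω
    rw [abs_le]
    simp only [h]
    split_ifs <;> constructor <;> linarith
  have hg : Measurable fun y : ℝ => y - m := measurable_id.sub_const m
  have hL : ∀ k, MemLp (fun ω => Y k ω - m) 2 μ := fun k =>
    ((hY.identDistrib k).memLp_iff.2 hY.memLp).sub (memLp_const m)
  have h0 : ∀ k, ∫ ω, (Y k ω - m) ∂μ = 0 := fun k => by
    rw [hY.integral_eq hg k, integral_sub (hY.integrable 0) (integrable_const m)]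
    simp [hm]
  have hv : ∀ k, ∫ ω, (Y k ω - m) ^ 2 ∂μ = Var[Y 0; μ] := fun k => by
    rw [hY.integral_eq (g := fun y => (y - m) ^ 2) (hg.pow_const 2) k,
      variance_eq_integral (hY.measurable 0).aemeasurable]
  have key := integral_sq_sum_mul_of_measurable_past hY.measurable hY.indep hh hb hg hL h0 hv
  have hNi : Integrable (fun ω => |(renewalCount Y α ω : ℝ) + 1 - n|) μ :=
    (((hY.integrable_renewalCount hα).add (integrable_const 1)).sub (integrable_const _)).abs
  have hlim : ∀ᵐ ω ∂μ, Tendsto (fun K => ∑ k ∈ Finset.range K, h k ω * (Y k ω - m)) atTop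
      (𝓝 (∑ k ∈ Finset.range (renewalCount Y α ω + 1), (Y k ω - m)
        - ∑ k ∈ Finset.range n, (Y k ω - m))) := by
    filter_upwards [hY.ae_tendsto_sum_reachedInd_mul hα fun k ω => Y k ω - m] with ω hω
    have e : ∀ K, ∑ k ∈ Finset.range K, h k ω * (Y k ω - m)
        = ∑ k ∈ Finset.range K, reachedInd Y α k ω * (Y k ω - m)
          - ∑ k ∈ Finset.range K, (if k < n then 1 else 0) * (Y k ω - m) := fun K => by
      rw [← Finset.sum_sub_distrib]
      exact Finset.sum_congr rfl fun k _ => sub_mul _ _ _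
    simp_rw [e]
    refine hω.sub (tendsto_const_nhds.congr' ?_)
    filter_upwards [eventually_ge_atTop n] with K hK
    simp only [ite_mul, one_mul, zero_mul]
    rw [← Finset.sum_filter]
    refine Finset.sum_congr ?_ fun _ _ => rfl
    ext k
    simp only [Finset.mem_filter, Finset.mem_range]
    omega
  refine integrable_and_integral_abs_le_of_tendsto
    (fun K => (key K).1.integrable one_le_two) (fun K => ?_) hlim
  refine (integral_abs_le_sqrt (key K).1).trans (Real.sqrt_le_sqrt ?_)
  rw [(key K).2]
  refine mul_le_mul_of_nonneg_left ?_ (variance_nonneg _ _)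
  have hsq : ∀ k, Integrable (fun ω => h k ω ^ 2) μ := fun k => by
    refine Integrable.of_bound ((hhm k).pow_const 2).aestronglyMeasurable 1
      (ae_of_all _ fun ω => ?_)
    rw [Real.norm_eq_abs, abs_pow]
    exact pow_le_one₀ (abs_nonneg _) (hb k ω)
  rw [← integral_finsetSum _ fun k _ => hsq k]
  refine integral_mono_ae (integrable_finsetSum _ fun k _ => hsq k) hNi ?_
  filter_upwards [hY.ae_reachedInd_eq hα] with ω hω
  have := sum_sq_indicator_sub_indicator_le (renewalCount Y α ω + 1) n K
  push_cast at this
  simpa only [h, hω] using this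

variable {lam : ℝ}

/-- `N - λ α` is `λ` times the overshoot minus `λ` times the centered sum, so it is
`O(√α)` in mean. -/
lemma exists_integral_abs_renewalCount_sub_le (hY : IsRenewalSequence μ Y) (hlam : 0 < lam)
    (hmean : ∫ ω, Y 0 ω ∂μ = 1 / lam) :
    ∃ B, ∀ᶠ α : ℝ in atTop, ∫ ω, |(renewalCount Y α ω : ℝ) + 1 - lam * α| ∂μ ≤ B * √α := by
  refine ⟨lam + lam * √(Var[Y 0; μ] * (2 * lam)), ?_⟩
  filter_upwards [hY.tendsto_excess_div_sqrt.eventually (gt_mem_nhds one_pos),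
    eventually_ge_atTop 1] with α hr hα1
  have hα : 0 ≤ α := zero_le_one.trans hα1
  have hs : 0 < √α := Real.sqrt_pos.2 (by linarith)
  have hss : √α ≤ α := by
    rw [Real.sqrt_le_left hα]
    nlinarith
  rw [div_lt_one hs] at hr
  have hN := hY.integrable_renewalCount hα
  obtain ⟨iR, eR⟩ := hY.integral_overshoot hα
  -- the case `n = 0` compares `C_N` with the empty sum
  obtain ⟨iC, eC⟩ := hY.integral_abs_sum_sub_sum_le hα 0
  set m := ∫ ω, Y 0 ω ∂μ with hm
  simp only [Finset.range_zero, Finset.sum_empty, sub_zero, Nat.cast_zero] at iC eC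
  have hEN : ∫ ω, |(renewalCount Y α ω : ℝ) + 1| ∂μ ≤ 2 * lam * α := by
    have : ∀ ω, |(renewalCount Y α ω : ℝ) + 1| = (renewalCount Y α ω : ℝ) + 1 := fun ω =>
      abs_of_nonneg (by positivity)
    simp_rw [this]
    rw [integral_add hN (integrable_const 1)]
    simp only [integral_const, probReal_univ, smul_eq_mul, mul_one]
    rw [hmean, mul_one_div, sub_lt_iff_lt_add, div_lt_iff₀ hlam] at hr
    nlinarith
  calc ∫ ω, |(renewalCount Y α ω : ℝ) + 1 - lam * α| ∂μ
      ≤ ∫ ω, (lam * |∑ k ∈ Finset.range (renewalCount Y α ω + 1), Y k ω - α|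
          + lam * |∑ k ∈ Finset.range (renewalCount Y α ω + 1), (Y k ω - m)|) ∂μ := by
        refine integral_mono
          ((hN.add (integrable_const 1)).sub (integrable_const _)).abs
          ((iR.abs.const_mul lam).add (iC.abs.const_mul lam)) fun ω => ?_
        simp only [Finset.sum_sub_distrib, Finset.sum_const, Finset.card_range, nsmul_eq_mul,
          hmean]
        rw [← abs_of_pos hlam, ← abs_mul, ← abs_mul, abs_of_pos hlam]
        refine le_trans (le_of_eq ?_) (abs_sub _ _)
        congr 1
        push_cast
        field_simp
        ring
    _ ≤ lam * √α + lam * √(Var[Y 0; μ] * (2 * lam * α)) := by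
        rw [integral_add (iR.abs.const_mul lam) (iC.abs.const_mul lam), integral_const_mul,
          integral_const_mul, eR]
        refine add_le_add (mul_le_mul_of_nonneg_left hr.le hlam.le)
          (mul_le_mul_of_nonneg_left (eC.trans (Real.sqrt_le_sqrt ?_)) hlam.le)
        exact mul_le_mul_of_nonneg_left hEN (variance_nonneg _ _)
    _ = _ := by
        rw [← mul_assoc, Real.sqrt_mul (mul_nonneg (variance_nonneg _ _) (by positivity))]
        ring

/-- The same bound around the integer part of `λ α`. -/
lemma exists_integral_abs_renewalCount_sub_floor_le (hY : IsRenewalSequence μ Y) (hlam : 0 < lam)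
    (hmean : ∫ ω, Y 0 ω ∂μ = 1 / lam) :
    ∃ B, ∀ᶠ α : ℝ in atTop,
      ∫ ω, |(renewalCount Y α ω : ℝ) + 1 - ⌊lam * α⌋₊| ∂μ ≤ B * √α := by
  obtain ⟨B, hB⟩ := hY.exists_integral_abs_renewalCount_sub_le hlam hmean
  refine ⟨B + 1, ?_⟩
  filter_upwards [hB, eventually_ge_atTop 1] with α h hα1
  have hα : 0 ≤ α := zero_le_one.trans hα1
  have hs : 1 ≤ √α := Real.one_le_sqrt.2 hα1
  have hN := hY.integrable_renewalCount hα
  have hi : Integrable (fun ω => |(renewalCount Y α ω : ℝ) + 1 - lam * α|) μ :=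
    ((hN.add (integrable_const 1)).sub (integrable_const _)).abs
  calc ∫ ω, |(renewalCount Y α ω : ℝ) + 1 - ⌊lam * α⌋₊| ∂μ
      ≤ ∫ ω, (|(renewalCount Y α ω : ℝ) + 1 - lam * α| + 1) ∂μ := by
        refine integral_mono ((hN.add (integrable_const 1)).sub (integrable_const _)).abs
          (hi.add (integrable_const 1)) fun ω => ?_
        have h1 := Nat.floor_le (mul_nonneg hlam.le hα)
        have h2 := Nat.lt_floor_add_one (lam * α)
        have h3 := abs_sub_abs_le_abs_sub ((renewalCount Y α ω : ℝ) + 1 - ⌊lam * α⌋₊)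
          ((renewalCount Y α ω : ℝ) + 1 - lam * α)
        have h4 : |(renewalCount Y α ω : ℝ) + 1 - ⌊lam * α⌋₊
          - ((renewalCount Y α ω : ℝ) + 1 - lam * α)| ≤ 1 := by
          rw [abs_le]; constructor <;> linarith
        show _ ≤ |(renewalCount Y α ω : ℝ) + 1 - lam * α| + 1
        linarith
    _ ≤ B * √α + √α := by
        rw [integral_add hi (integrable_const 1)]
        simp only [integral_const, probReal_univ, smul_eq_mul, mul_one]
        linarith
    _ = _ := by ring

/-- The renewal count is `λ α + o(α)` in mean. -/
lemma tendsto_integral_abs_renewalCount_sub_floor (hY : IsRenewalSequence μ Y) (hlam : 0 < lam)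
    (hmean : ∫ ω, Y 0 ω ∂μ = 1 / lam) :
    Tendsto (fun α : ℝ => (∫ ω, |(renewalCount Y α ω : ℝ) - ⌊lam * α⌋₊| ∂μ) / α)
      atTop (𝓝 0) := by
  obtain ⟨B, hB⟩ := hY.exists_integral_abs_renewalCount_sub_floor_le hlam hmean
  have hlim : Tendsto (fun α : ℝ => (B + 1) * (√α)⁻¹) atTop (𝓝 0) := by
    simpa using (tendsto_inv_atTop_zero.comp Real.tendsto_sqrt_atTop).const_mul (B + 1)
  refine squeeze_zero' ?_ ?_ hlim
  · filter_upwards [eventually_ge_atTop 0] with α hα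
    exact div_nonneg (integral_nonneg fun _ => abs_nonneg _) hα
  filter_upwards [hB, eventually_ge_atTop 1] with α h hα1
  have hα : 0 ≤ α := zero_le_one.trans hα1
  have hs : 1 ≤ √α := Real.one_le_sqrt.2 hα1
  have hss : √α * √α = α := Real.mul_self_sqrt hα
  have hN := hY.integrable_renewalCount hα
  have hi : Integrable (fun ω => |(renewalCount Y α ω : ℝ) + 1 - ⌊lam * α⌋₊|) μ :=
    ((hN.add (integrable_const 1)).sub (integrable_const _)).abs
  rw [div_le_iff₀ (by linarith)]
  calc ∫ ω, |(renewalCount Y α ω : ℝ) - ⌊lam * α⌋₊| ∂μ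
      ≤ ∫ ω, (|(renewalCount Y α ω : ℝ) + 1 - ⌊lam * α⌋₊| + 1) ∂μ := by
        refine integral_mono (hN.sub (integrable_const _)).abs
          (hi.add (integrable_const 1)) fun ω => ?_
        have h3 := abs_sub_abs_le_abs_sub ((renewalCount Y α ω : ℝ) - ⌊lam * α⌋₊)
          ((renewalCount Y α ω : ℝ) + 1 - ⌊lam * α⌋₊)
        have h4 : |(renewalCount Y α ω : ℝ) - ⌊lam * α⌋₊
          - ((renewalCount Y α ω : ℝ) + 1 - ⌊lam * α⌋₊)| ≤ 1 := by
          rw [abs_le]; constructor <;> linarith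
        show _ ≤ |(renewalCount Y α ω : ℝ) + 1 - ⌊lam * α⌋₊| + 1
        linarith
    _ ≤ B * √α + √α := by
        rw [integral_add hi (integrable_const 1)]
        simp only [integral_const, probReal_univ, smul_eq_mul, mul_one]
        linarith
    _ = (B + 1) * (√α)⁻¹ * α := by
        nth_rewrite 4 [← hss]
        field_simp

/-- The fluctuations of the renewal count around its mean are, up to `o(√α)` in mean, `-λ` times
those of the centered sum of the first `⌊λ α⌋` inter-arrival times. -/
lemma tendsto_integral_abs_renewalCount_sub_add (hY : IsRenewalSequence μ Y) (hlam : 0 < lam)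
    (hmean : ∫ ω, Y 0 ω ∂μ = 1 / lam) :
    Tendsto (fun α : ℝ => (∫ ω, |(renewalCount Y α ω : ℝ)
        - ∫ ω', (renewalCount Y α ω' : ℝ) ∂μ
        + lam * ∑ k ∈ Finset.range ⌊lam * α⌋₊, (Y k ω - 1 / lam)| ∂μ) / √α) atTop (𝓝 0) := by
  obtain ⟨B, hB⟩ := hY.exists_integral_abs_renewalCount_sub_floor_le hlam hmean
  have hlim : Tendsto (fun α : ℝ => 2 * lam *
      (((∫ ω, (renewalCount Y α ω : ℝ) ∂μ + 1) * ∫ ω, Y 0 ω ∂μ - α) / √α)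
      + lam * √(Var[Y 0; μ] * B * (√α)⁻¹)) atTop (𝓝 0) := by
    have h1 := hY.tendsto_excess_div_sqrt.const_mul (2 * lam)
    have h2 : Tendsto (fun α : ℝ => lam * √(Var[Y 0; μ] * B * (√α)⁻¹)) atTop (𝓝 0) := by
      have := (Real.continuous_sqrt.tendsto _).comp
        ((tendsto_inv_atTop_zero.comp Real.tendsto_sqrt_atTop).const_mul (Var[Y 0; μ] * B))
      simpa using this.const_mul lam
    simpa using h1.add h2
  refine squeeze_zero' (Eventually.of_forall fun α =>
    div_nonneg (integral_nonneg fun _ => abs_nonneg _) (Real.sqrt_nonneg _)) ?_ hlim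
  filter_upwards [hB, eventually_ge_atTop 1] with α h hα1
  have hα : 0 ≤ α := zero_le_one.trans hα1
  have hs : 0 < √α := Real.sqrt_pos.2 (by linarith)
  have hss : √α * √α = α := Real.mul_self_sqrt hα
  have hN := hY.integrable_renewalCount hα
  have hr := hY.excess_nonneg hα
  obtain ⟨iR, eR⟩ := hY.integral_overshoot hα
  obtain ⟨iC, eC⟩ := hY.integral_abs_sum_sub_sum_le hα ⌊lam * α⌋₊
  rw [hmean] at hr eR iC eC ⊢
  set EM := ∫ ω', (renewalCount Y α ω' : ℝ) ∂μ with hEM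
  set r := (EM + 1) * (1 / lam) - α with hrdef
  have iC' : Integrable (fun ω => ∑ k ∈ Finset.range ⌊lam * α⌋₊, (Y k ω - 1 / lam)) μ :=
    integrable_finsetSum _ fun k _ => (hY.integrable k).sub (integrable_const _)
  have hsq : √(Var[Y 0; μ] * (B * √α)) = √(Var[Y 0; μ] * B * (√α)⁻¹) * √α := by
    have : Var[Y 0; μ] * (B * √α) = Var[Y 0; μ] * B * (√α)⁻¹ * α := by
      nth_rewrite 3 [← hss]
      field_simp
    rw [this, Real.sqrt_mul' _ hα]
  rw [div_le_iff₀ hs]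
  calc ∫ ω, |(renewalCount Y α ω : ℝ) - EM
        + lam * ∑ k ∈ Finset.range ⌊lam * α⌋₊, (Y k ω - 1 / lam)| ∂μ
      ≤ ∫ ω, (lam * (|∑ k ∈ Finset.range (renewalCount Y α ω + 1), Y k ω - α| + r)
          + lam * |∑ k ∈ Finset.range (renewalCount Y α ω + 1), (Y k ω - 1 / lam)
              - ∑ k ∈ Finset.range ⌊lam * α⌋₊, (Y k ω - 1 / lam)|) ∂μ := by
        refine integral_mono ((hN.sub (integrable_const _)).add (iC'.const_mul lam)).abs
          (((iR.abs.add (integrable_const r)).const_mul lam).add (iC.abs.const_mul lam))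
          fun ω => ?_
        set R := ∑ k ∈ Finset.range (renewalCount Y α ω + 1), Y k ω - α with hR
        set C := ∑ k ∈ Finset.range ⌊lam * α⌋₊, (Y k ω - 1 / lam) with hC
        have e : ∑ k ∈ Finset.range (renewalCount Y α ω + 1), (Y k ω - 1 / lam)
            = R + α - ((renewalCount Y α ω : ℝ) + 1) * (1 / lam) := by
          rw [hR, Finset.sum_sub_distrib]
          simp
        have e2 : (renewalCount Y α ω : ℝ) - EM + lam * C = lam * ((R - r)
            - (∑ k ∈ Finset.range (renewalCount Y α ω + 1), (Y k ω - 1 / lam) - C)) := by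
          rw [e, hrdef]
          field_simp
          ring
        show |(renewalCount Y α ω : ℝ) - EM + lam * C| ≤ lam * (|R| + r) + lam *
          |∑ k ∈ Finset.range (renewalCount Y α ω + 1), (Y k ω - 1 / lam) - C|
        rw [e2, abs_mul, abs_of_pos hlam, ← mul_add]
        refine mul_le_mul_of_nonneg_left ((abs_sub _ _).trans ?_) hlam.le
        gcongr
        refine (abs_sub _ _).trans ?_
        rw [abs_of_nonneg hr]
    _ ≤ lam * (r + r) + lam * √(Var[Y 0; μ] * (B * √α)) := by
        have iRr : Integrable (fun ω =>
            |∑ k ∈ Finset.range (renewalCount Y α ω + 1), Y k ω - α| + r) μ :=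
          iR.abs.add (integrable_const r)
        rw [integral_add (iRr.const_mul lam) (iC.abs.const_mul lam),
          integral_const_mul, integral_const_mul, integral_add iR.abs (integrable_const r), eR]
        simp only [integral_const, probReal_univ, smul_eq_mul, one_mul]
        gcongr
        exact eC.trans (Real.sqrt_le_sqrt (mul_le_mul_of_nonneg_left h (variance_nonneg _ _)))
    _ = _ := by
        rw [hsq]
        field_simp
        ring

end IsRenewalSequence

/-! ### Powers of characteristic functions -/

lemma norm_pow_sub_pow_le_abs_sub_mul {z : ℂ} (hz : ‖z‖ ≤ 1) (a b : ℕ) :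
    ‖z ^ a - z ^ b‖ ≤ |(a : ℝ) - b| * ‖z - 1‖ := by
  wlog hab : b ≤ a generalizing a b
  · rw [norm_sub_rev, abs_sub_comm]
    exact this b a (le_of_not_ge hab)
  obtain ⟨k, rfl⟩ := Nat.exists_eq_add_of_le hab
  have hk : ‖z ^ k - 1‖ ≤ k * ‖z - 1‖ := by
    induction k with
    | zero => simp
    | succ k ih =>
      have e : z ^ (k + 1) - 1 = z * (z ^ k - 1) + (z - 1) := by ring
      rw [e]
      refine (norm_add_le _ _).trans ?_
      rw [norm_mul]
      have := mul_le_mul hz (ih (by omega)) (norm_nonneg _) zero_le_one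
      push_cast
      linarith
  rw [show z ^ (b + k) - z ^ b = z ^ b * (z ^ k - 1) by ring, norm_mul, norm_pow]
  push_cast
  rw [add_sub_cancel_left, abs_of_nonneg (Nat.cast_nonneg k)]
  exact (mul_le_of_le_one_left (norm_nonneg _) (pow_le_one₀ (norm_nonneg _) hz)).trans hk

section

variable {Ω : Type*} [MeasurableSpace Ω] {μ : Measure Ω} [IsProbabilityMeasure μ] {X : Ω → ℝ}

/-- Second-order expansion of the characteristic function of a centered variable. -/
lemma tendsto_mul_charFun_sub_one (hX : Measurable X) (hX2 : MemLp X 2 μ)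
    (h0 : ∫ ω, X ω ∂μ = 0) (t : ℝ) :
    Tendsto (fun α : ℝ => (α : ℂ) * (charFun (μ.map X) (t * (√α)⁻¹) - 1)) atTop
      (𝓝 (-((∫ ω, X ω ^ 2 ∂μ : ℝ) : ℂ) * t ^ 2 / 2)) := by
  have : IsProbabilityMeasure (μ.map X) := Measure.isProbabilityMeasure_map hX.aemeasurable
  have hL : MemLp id 2 (μ.map X) := (memLp_map_measure_iff
    measurable_id.aestronglyMeasurable hX.aemeasurable).2 (by simpa using hX2)
  set V := ∫ ω, X ω ^ 2 ∂μ with hV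
  have taylor : (fun s : ℝ => charFun (μ.map X) s - (1 - (V : ℂ) * s ^ 2 / 2))
      =o[𝓝 0] fun s : ℝ => s ^ 2 := by
    have h := taylor_isLittleO_univ (f := charFun (μ.map X)) (x₀ := 0) (n := 2)
      (contDiff_charFun hL)
    simp only [taylorWithinEval_charFun_two_zero hX.aemeasurable hL, sub_zero] at h
    refine h.congr_left fun s => ?_
    simp [h0, hV]
  have hs : Tendsto (fun α : ℝ => t * (√α)⁻¹) atTop (𝓝 0) := by
    simpa using (tendsto_inv_atTop_zero.comp Real.tendsto_sqrt_atTop).const_mul t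
  have h1 := taylor.comp_tendsto hs
  have h2 : (fun α : ℝ => (α : ℂ) * (charFun (μ.map X) (t * (√α)⁻¹) - 1)
      - (-(V : ℂ) * t ^ 2 / 2)) =o[atTop] fun _ : ℝ => t ^ 2 := by
    have h3 : (fun α : ℝ => (α : ℂ) * (charFun (μ.map X) (t * (√α)⁻¹)
        - (1 - (V : ℂ) * ((t * (√α)⁻¹ : ℝ) : ℂ) ^ 2 / 2)))
        =o[atTop] fun α : ℝ => ‖(α : ℂ)‖ * (t * (√α)⁻¹) ^ 2 :=
      (Asymptotics.isBigO_of_le atTop fun α => by simp :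
        (fun α : ℝ => (α : ℂ)) =O[atTop] fun α : ℝ => ‖(α : ℂ)‖).mul_isLittleO h1
    refine h3.congr' ?_ ?_
    · filter_upwards [eventually_gt_atTop 0] with α hα
      have hss : ((√α : ℝ) : ℂ) ^ 2 = α := by
        rw [← Complex.ofReal_pow, Real.sq_sqrt hα.le]
      have hne : (α : ℂ) ≠ 0 := by exact_mod_cast hα.ne'
      push_cast
      rw [mul_pow, inv_pow, hss]
      field_simp
      ring
    · filter_upwards [eventually_gt_atTop 0] with α hα
      rw [Complex.norm_real, Real.norm_of_nonneg hα.le, mul_pow, inv_pow, Real.sq_sqrt hα.le]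
      field_simp
  have h4 := h2.trans_isBigO (Asymptotics.isBigO_const_const (t ^ 2) (one_ne_zero' ℝ) atTop)
  exact tendsto_sub_nhds_zero_iff.1 ((Asymptotics.isLittleO_one_iff ℝ).1 h4)

/-- The limit behind the central limit theorem, along the indices `⌊λ α⌋` with a real parameter
`α`. -/
lemma tendsto_charFun_pow_floor (hX : Measurable X) (hX2 : MemLp X 2 μ)
    (h0 : ∫ ω, X ω ∂μ = 0) (t : ℝ) {lam : ℝ} (hlam : 0 ≤ lam) :
    Tendsto (fun α : ℝ => charFun (μ.map X) (t * (√α)⁻¹) ^ ⌊lam * α⌋₊) atTop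
      (𝓝 (Complex.exp (-(lam * (∫ ω, X ω ^ 2 ∂μ) * t ^ 2 / 2 : ℝ)))) := by
  have hg := tendsto_mul_charFun_sub_one hX hX2 h0 t
  have hlog := Complex.tendsto_mul_log_one_add_of_tendsto hg
  have hfl : Tendsto (fun α : ℝ => (((⌊lam * α⌋₊ : ℝ) / α : ℝ) : ℂ)) atTop (𝓝 (lam : ℂ)) :=
    (Complex.continuous_ofReal.tendsto _).comp (tendsto_nat_floor_mul_div_atTop hlam)
  have hexp := (Complex.continuous_exp.tendsto _).comp (hfl.mul hlog)
  -- nonvanishing, so that the power is the exponential of a multiple of the logarithm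
  have hne : ∀ᶠ α : ℝ in atTop, charFun (μ.map X) (t * (√α)⁻¹) ≠ 0 := by
    have hs : Tendsto (fun α : ℝ => t * (√α)⁻¹) atTop (𝓝 0) := by
      simpa using (tendsto_inv_atTop_zero.comp Real.tendsto_sqrt_atTop).const_mul t
    have : IsProbabilityMeasure (μ.map X) := Measure.isProbabilityMeasure_map hX.aemeasurable
    have hc := ((continuous_charFun (μ := μ.map X)).tendsto 0).comp hs
    rw [charFun_zero] at hc
    refine hc.eventually_ne (by simp)
  refine Tendsto.congr' ?_ (hexp.trans (le_of_eq ?_))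
  · filter_upwards [hne, eventually_gt_atTop 0] with α h hα
    have hne : (α : ℂ) ≠ 0 := by exact_mod_cast hα.ne'
    simp only [Function.comp, add_sub_cancel]
    push_cast
    rw [div_mul_eq_mul_div, mul_left_comm, mul_div_cancel_left₀ _ hne, Complex.exp_nat_mul,
      Complex.exp_log h]
  · congr 2
    push_cast
    ring

end

/-! ### Random sums with an independent number of terms -/

section

variable {Ω 𝓧 𝓦 : Type*} [MeasurableSpace Ω] [MeasurableSpace 𝓧] [MeasurableSpace 𝓦]
  {μ : Measure Ω} [IsProbabilityMeasure μ] {E : Type*} [NormedAddCommGroup E]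
  {N : Ω → 𝓧} {W : Ω → 𝓦}

/-- Fubini's theorem for independent variables: integrability of `F (N, W)`. -/
lemma integrable_comp_prodMk_of_indepFun (h : IndepFun N W μ) (hN : Measurable N)
    (hW : Measurable W) {F : 𝓧 × 𝓦 → E} (hF : StronglyMeasurable F)
    (h1 : ∀ x, Integrable (fun ω => F (x, W ω)) μ)
    (h2 : Integrable (fun ω => ∫ ω', ‖F (N ω, W ω')‖ ∂μ) μ) :
    Integrable (fun ω => F (N ω, W ω)) μ := by
  have hmap := (indepFun_iff_map_prod_eq_prod_map_map hN.aemeasurable hW.aemeasurable).1 h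
  have : IsProbabilityMeasure (μ.map W) := Measure.isProbabilityMeasure_map hW.aemeasurable
  have : IsProbabilityMeasure (μ.map N) := Measure.isProbabilityMeasure_map hN.aemeasurable
  have key : Integrable F (μ.map fun ω => (N ω, W ω)) := by
    rw [hmap, integrable_prod_iff hF.aestronglyMeasurable]
    refine ⟨ae_of_all _ fun x => ?_, ?_⟩
    · exact (integrable_map_measure (hF.comp_measurable measurable_prodMk_left).aestronglyMeasurable
        hW.aemeasurable).2 (h1 x)
    · rw [integrable_map_measure
        hF.norm.integral_prod_right'.aestronglyMeasurable hN.aemeasurable]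
      refine h2.congr (ae_of_all _ fun ω => ?_)
      exact (integral_map hW.aemeasurable
        (hF.norm.comp_measurable measurable_prodMk_left).aestronglyMeasurable).symm
  exact (integrable_map_measure hF.aestronglyMeasurable (hN.prodMk hW).aemeasurable).1 key

lemma integral_comp_prodMk_of_indepFun [NormedSpace ℝ E] (h : IndepFun N W μ) (hN : Measurable N)
    (hW : Measurable W) {F : 𝓧 × 𝓦 → E} (hF : StronglyMeasurable F)
    (hi : Integrable (fun ω => F (N ω, W ω)) μ) :
    ∫ ω, F (N ω, W ω) ∂μ = ∫ ω, ∫ ω', F (N ω, W ω') ∂μ ∂μ := by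
  have hmap := (indepFun_iff_map_prod_eq_prod_map_map hN.aemeasurable hW.aemeasurable).1 h
  have : IsProbabilityMeasure (μ.map W) := Measure.isProbabilityMeasure_map hW.aemeasurable
  have : IsProbabilityMeasure (μ.map N) := Measure.isProbabilityMeasure_map hN.aemeasurable
  have hi' : Integrable F ((μ.map N).prod (μ.map W)) := by
    rw [← hmap]
    exact (integrable_map_measure hF.aestronglyMeasurable (hN.prodMk hW).aemeasurable).2 hi
  rw [← integral_map (φ := fun ω => (N ω, W ω)) (hN.prodMk hW).aemeasurable
    hF.aestronglyMeasurable, hmap, integral_prod _ hi',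
    integral_map hN.aemeasurable hF.integral_prod_right'.aestronglyMeasurable]
  refine integral_congr_ae (ae_of_all _ fun ω => ?_)
  exact integral_map hW.aemeasurable
    (hF.comp_measurable measurable_prodMk_left).aestronglyMeasurable

end

section

variable {Ω : Type*} [MeasurableSpace Ω] {μ : Measure Ω}

lemma integral_exp_sum_eq_pow {X : ℕ → Ω → ℝ} (hX : ∀ k, Measurable (X k))
    (hXind : iIndepFun X μ) (hid : ∀ k, IdentDistrib (X k) (X 0) μ μ) (n : ℕ) (s : ℝ) :
    ∫ ω, Complex.exp (s * (∑ k ∈ Finset.range n, X k ω : ℝ) * Complex.I) ∂μ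
      = charFun (μ.map (X 0)) s ^ n := by
  have hm : Measurable fun ω => ∑ k ∈ Finset.range n, X k ω :=
    Finset.measurable_fun_sum _ fun k _ => hX k
  have h := congrFun ((hXind.restrict (Finset.range n)).charFun_map_fun_finsetSum_eq_prod
    fun k _ => (hX k).aemeasurable) s
  rwa [Finset.prod_congr rfl fun k _ => by rw [(hid k).map_eq], Finset.prod_const,
    Finset.card_range, Pi.pow_apply, charFun_apply_real, integral_map hm.aemeasurable
    (by fun_prop)] at h

variable [IsProbabilityMeasure μ] {N : Ω → ℕ}

/-- Integrability and mean of a random sum whose number of terms is independent of the terms. -/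
lemma integrable_and_integral_random_sum {E : Type*} [NormedAddCommGroup E] [NormedSpace ℝ E]
    [MeasurableSpace E] [BorelSpace E] [SecondCountableTopology E]
    [CompleteSpace E] {X : ℕ → Ω → E}
    (hX : ∀ k, Measurable (X k)) (hXi : Integrable (X 0) μ)
    (hid : ∀ k, IdentDistrib (X k) (X 0) μ μ) (hN : Measurable N)
    (hNi : Integrable (fun ω => (N ω : ℝ)) μ) (hind : IndepFun N (fun ω k => X k ω) μ) :
    Integrable (fun ω => ∑ k ∈ Finset.range (N ω), X k ω) μ ∧
    ∫ ω, ∑ k ∈ Finset.range (N ω), X k ω ∂μ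
      = (∫ ω, (N ω : ℝ) ∂μ) • ∫ ω, X 0 ω ∂μ := by
  have hW : Measurable fun ω k => X k ω := measurable_pi_lambda _ hX
  have hi : ∀ k, Integrable (X k) μ := fun k => (hid k).integrable_iff.2 hXi
  have hF : StronglyMeasurable fun p : ℕ × (ℕ → E) => ∑ k ∈ Finset.range p.1, p.2 k :=
    (measurable_from_prod_countable_right fun n =>
      Finset.measurable_fun_sum (Finset.range n) fun k _ =>
        measurable_pi_apply k).stronglyMeasurable
  have hs : ∀ n : ℕ, Integrable (fun ω => ∑ k ∈ Finset.range n, X k ω) μ := fun n =>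
    integrable_finsetSum _ fun k _ => hi k
  have hint : Integrable (fun ω => ∑ k ∈ Finset.range (N ω), X k ω) μ := by
    refine integrable_comp_prodMk_of_indepFun hind hN hW hF hs ?_
    refine (hNi.mul_const (∫ ω, ‖X 0 ω‖ ∂μ)).mono
      ((measurable_from_nat (f := fun n : ℕ =>
        ∫ ω', ‖∑ k ∈ Finset.range n, X k ω'‖ ∂μ)).comp hN).aestronglyMeasurable
      (ae_of_all _ fun ω => ?_)
    rw [Real.norm_of_nonneg (integral_nonneg fun _ => norm_nonneg _), Real.norm_of_nonneg
      (mul_nonneg (Nat.cast_nonneg _) (integral_nonneg fun _ => norm_nonneg _))]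
    calc ∫ ω', ‖∑ k ∈ Finset.range (N ω), X k ω'‖ ∂μ
        ≤ ∫ ω', ∑ k ∈ Finset.range (N ω), ‖X k ω'‖ ∂μ :=
          integral_mono (hs _).norm (integrable_finsetSum _ fun k _ => (hi k).norm)
            fun ω' => norm_sum_le _ _
      _ = N ω * ∫ ω, ‖X 0 ω‖ ∂μ := by
          rw [integral_finsetSum _ fun k _ => (hi k).norm]
          simp [fun k => ((hid k).norm).integral_eq]
  refine ⟨hint, ?_⟩
  rw [integral_comp_prodMk_of_indepFun hind hN hW hF hint, ← integral_smul_const]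
  refine integral_congr_ae (ae_of_all _ fun ω => ?_)
  simp only
  rw [integral_finsetSum _ fun k _ => hi k]
  simp [fun k => (hid k).integral_eq, Nat.cast_smul_eq_nsmul]

/-- Conditioning on the number of terms turns the characteristic function of a random sum into a
random power. -/
lemma integral_exp_random_sum {X : ℕ → Ω → ℝ} (hX : ∀ k, Measurable (X k))
    (hXind : iIndepFun X μ) (hid : ∀ k, IdentDistrib (X k) (X 0) μ μ) (hN : Measurable N)
    (hind : IndepFun N (fun ω k => X k ω) μ) (s : ℝ) {w : ℕ → ℂ} (hw : ∀ n, ‖w n‖ ≤ 1) :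
    ∫ ω, Complex.exp (s * (∑ k ∈ Finset.range (N ω), X k ω : ℝ) * Complex.I) * w (N ω) ∂μ
      = ∫ ω, charFun (μ.map (X 0)) s ^ N ω * w (N ω) ∂μ := by
  have hW : Measurable fun ω k => X k ω := measurable_pi_lambda _ hX
  have hF : StronglyMeasurable fun p : ℕ × (ℕ → ℝ) =>
      Complex.exp (s * (∑ k ∈ Finset.range p.1, p.2 k : ℝ) * Complex.I) * w p.1 := by
    refine (measurable_from_prod_countable_right fun n => ?_).stronglyMeasurable
    have : Measurable fun x : ℕ → ℝ => ∑ k ∈ Finset.range n, x k :=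
      Finset.measurable_fun_sum (Finset.range n) fun k _ => measurable_pi_apply k
    show Measurable fun x : ℕ → ℝ =>
      Complex.exp (s * (∑ k ∈ Finset.range n, x k : ℝ) * Complex.I) * w n
    fun_prop
  have hint : Integrable (fun ω =>
      Complex.exp (s * (∑ k ∈ Finset.range (N ω), X k ω : ℝ) * Complex.I) * w (N ω)) μ := by
    refine Integrable.of_bound (hF.comp_measurable (hN.prodMk hW)).aestronglyMeasurable 1
      (ae_of_all _ fun ω => ?_)
    rw [norm_mul, ← Complex.ofReal_mul, Complex.norm_exp_ofReal_mul_I, one_mul]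
    exact hw _
  rw [integral_comp_prodMk_of_indepFun hind hN hW hF hint]
  refine integral_congr_ae (ae_of_all _ fun ω => ?_)
  simp only
  rw [integral_mul_const, integral_exp_sum_eq_pow hX hXind hid]

end

/-! ### Compound renewal sums with real summands -/

lemma norm_exp_ofReal_mul_I_sub_le (x y : ℝ) :
    ‖Complex.exp (x * Complex.I) - Complex.exp (y * Complex.I)‖ ≤ |x - y| := by
  have e : Complex.exp (x * Complex.I) - Complex.exp (y * Complex.I)
      = Complex.exp (y * Complex.I) * (Complex.exp (Complex.I * ((x - y : ℝ) : ℂ)) - 1) := by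
    rw [mul_sub, mul_one, ← Complex.exp_add]
    congr 2
    push_cast
    ring
  rw [e, norm_mul, Complex.norm_exp_ofReal_mul_I, one_mul]
  exact Real.norm_exp_I_mul_ofReal_sub_one_le

/-- The characteristic function of the centered and scaled compound sum. Conditionally on the
number of claims it is a power of the characteristic function of a centered claim times a factor
from the centered claim number. In the power the number may be replaced by `⌊λ α⌋`, in the factor
the centered number by `-λ` times the centered sum of the first `⌊λ α⌋` inter-arrival times. -/
theorem IsRenewalSequence.tendsto_integral_exp_compound {Ω : Type*} [MeasurableSpace Ω]
    {μ : Measure Ω} [IsProbabilityMeasure μ] {Y U : ℕ → Ω → ℝ} {lam : ℝ}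
    (hY : IsRenewalSequence μ Y) (hlam : 0 < lam) (hmean : ∫ ω, Y 0 ω ∂μ = 1 / lam)
    (hU : ∀ k, Measurable (U k)) (hU2 : MemLp (U 0) 2 μ) (hUind : iIndepFun U μ)
    (hUid : ∀ k, IdentDistrib (U k) (U 0) μ μ)
    (hind : ∀ α : ℝ, 0 ≤ α → IndepFun (renewalCount Y α) (fun ω k => U k ω) μ) :
    Tendsto (fun α : ℝ => ∫ ω, Complex.exp (((√α)⁻¹ *
        (∑ k ∈ Finset.range (renewalCount Y α ω), U k ω
          - (∫ ω', (renewalCount Y α ω' : ℝ) ∂μ) * ∫ ω', U 0 ω' ∂μ) : ℝ) * Complex.I) ∂μ)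
      atTop (𝓝 (Complex.exp (-((lam * Var[U 0; μ]
        + lam ^ 3 * Var[Y 0; μ] * (∫ ω', U 0 ω' ∂μ) ^ 2) / 2 : ℝ)))) := by
  set b := ∫ ω', U 0 ω' ∂μ with hb
  -- centering makes the characteristic functions `1 + O(1 / α)` at arguments of order `1 / √α`
  have hgU : Measurable fun u : ℝ => u - b := measurable_id.sub_const b
  have hX : ∀ k, Measurable fun ω => U k ω - b := fun k => (hU k).sub_const b
  have hXind : iIndepFun (fun k ω => U k ω - b) μ := hUind.comp (fun _ u => u - b) fun _ => hgU
  have hXid : ∀ k, IdentDistrib (fun ω => U k ω - b) (fun ω => U 0 ω - b) μ μ := fun k =>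
    (hUid k).comp hgU
  have hX2 : MemLp (fun ω => U 0 ω - b) 2 μ := hU2.sub (memLp_const b)
  have hX0 : ∫ ω, (U 0 ω - b) ∂μ = 0 := by
    rw [integral_sub (hU2.integrable one_le_two) (integrable_const b)]
    simp [hb]
  have hXv : ∫ ω, (U 0 ω - b) ^ 2 ∂μ = Var[U 0; μ] :=
    (variance_eq_integral (hU 0).aemeasurable).symm
  have hXN : ∀ α : ℝ, 0 ≤ α →
      IndepFun (renewalCount Y α) (fun ω k => U k ω - b) μ := fun α hα =>
    (hind α hα).comp (φ := id) (ψ := fun x : ℕ → ℝ => fun k => x k - b) measurable_id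
      (by fun_prop)
  have hgY : Measurable fun y : ℝ => y - 1 / lam := measurable_id.sub_const _
  have hC : ∀ k, Measurable fun ω => Y k ω - 1 / lam := fun k => (hY.measurable k).sub_const _
  have hCind : iIndepFun (fun k ω => Y k ω - 1 / lam) μ :=
    hY.indep.comp (fun _ y => y - 1 / lam) fun _ => hgY
  have hCid : ∀ k, IdentDistrib (fun ω => Y k ω - 1 / lam) (fun ω => Y 0 ω - 1 / lam) μ μ :=
    fun k => (hY.identDistrib k).comp hgY
  have hC2 : MemLp (fun ω => Y 0 ω - 1 / lam) 2 μ := hY.memLp.sub (memLp_const _)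
  have hC0 : ∫ ω, (Y 0 ω - 1 / lam) ∂μ = 0 := by
    rw [integral_sub (hY.integrable 0) (integrable_const _), hmean]
    simp
  have hCv : ∫ ω, (Y 0 ω - 1 / lam) ^ 2 ∂μ = Var[Y 0; μ] := by
    rw [variance_eq_integral (hY.measurable 0).aemeasurable, hmean]
  set φ : ℝ → ℂ := fun α => charFun (μ.map fun ω => U 0 ω - b) (√α)⁻¹ with hφ
  set ψ : ℝ → ℂ := fun α => charFun (μ.map fun ω => Y 0 ω - 1 / lam) (-(b * lam) * (√α)⁻¹) with hψ
  have hlimφ : Tendsto (fun α => φ α ^ ⌊lam * α⌋₊) atTop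
      (𝓝 (Complex.exp (-(lam * Var[U 0; μ] * 1 ^ 2 / 2 : ℝ)))) := by
    have := tendsto_charFun_pow_floor (hX 0) hX2 hX0 1 hlam.le
    simpa only [hXv, one_mul] using this
  have hlimψ : Tendsto (fun α => ψ α ^ ⌊lam * α⌋₊) atTop
      (𝓝 (Complex.exp (-(lam * Var[Y 0; μ] * (-(b * lam)) ^ 2 / 2 : ℝ)))) := by
    have := tendsto_charFun_pow_floor (hC 0) hC2 hC0 (-(b * lam)) hlam.le
    simpa only [hCv] using this
  have hprod := hlimφ.mul hlimψ
  have hL : Complex.exp (-(lam * Var[U 0; μ] * 1 ^ 2 / 2 : ℝ))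
      * Complex.exp (-(lam * Var[Y 0; μ] * (-(b * lam)) ^ 2 / 2 : ℝ))
      = Complex.exp (-((lam * Var[U 0; μ] + lam ^ 3 * Var[Y 0; μ] * b ^ 2) / 2 : ℝ)) := by
    rw [← Complex.exp_add]
    congr 1
    push_cast
    ring
  rw [hL] at hprod
  -- `α (φ α - 1)` converges, so `M - ⌊λ α⌋ = o(α)` suffices in the power
  have herr : Tendsto (fun α : ℝ =>
      (∫ ω, |(renewalCount Y α ω : ℝ) - ⌊lam * α⌋₊| ∂μ) / α * ‖(α : ℂ) * (φ α - 1)‖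
      + |b| * ((∫ ω, |(renewalCount Y α ω : ℝ) - ∫ ω', (renewalCount Y α ω' : ℝ) ∂μ
        + lam * ∑ k ∈ Finset.range ⌊lam * α⌋₊, (Y k ω - 1 / lam)| ∂μ) / √α)) atTop (𝓝 0) := by
    have h1 := (tendsto_mul_charFun_sub_one (hX 0) hX2 hX0 1).norm
    simp only [one_mul] at h1
    have h2 := (hY.tendsto_integral_abs_renewalCount_sub_floor hlam hmean).mul h1
    have h3 := (hY.tendsto_integral_abs_renewalCount_sub_add hlam hmean).const_mul |b|
    simpa using h2.add h3
  have hdiff : Tendsto (fun α : ℝ => (∫ ω, Complex.exp (((√α)⁻¹ *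
        (∑ k ∈ Finset.range (renewalCount Y α ω), U k ω
          - (∫ ω', (renewalCount Y α ω' : ℝ) ∂μ) * b) : ℝ) * Complex.I) ∂μ)
        - φ α ^ ⌊lam * α⌋₊ * ψ α ^ ⌊lam * α⌋₊) atTop (𝓝 0) := by
    refine squeeze_zero_norm' ?_ herr
    filter_upwards [eventually_gt_atTop 0] with α hα0
    have hα : 0 ≤ α := hα0.le
    set s := (√α)⁻¹ with hs
    have hs0 : 0 ≤ s := inv_nonneg.2 (Real.sqrt_nonneg _)
    set n := ⌊lam * α⌋₊ with hn
    set EM := ∫ ω', (renewalCount Y α ω' : ℝ) ∂μ with hEM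
    have hM := measurable_renewalCount hY.measurable α
    have hMi := hY.integrable_renewalCount hα
    have : IsProbabilityMeasure (μ.map fun ω => U 0 ω - b) :=
      Measure.isProbabilityMeasure_map (hX 0).aemeasurable
    have hφ1 : ‖φ α‖ ≤ 1 := norm_charFun_le_one _
    let w : ℕ → ℂ := fun m => Complex.exp ((s * (b * (m - EM)) : ℝ) * Complex.I)
    have hw : ∀ m, ‖w m‖ ≤ 1 := fun m => (Complex.norm_exp_ofReal_mul_I _).le
    let C : Ω → ℝ := fun ω => ∑ k ∈ Finset.range n, (Y k ω - 1 / lam)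
    have hCm : Measurable C := Finset.measurable_fun_sum _ fun k _ => hC k
    have hCi : Integrable C μ :=
      integrable_finsetSum _ fun k _ => (hY.integrable k).sub (integrable_const _)
    let g : Ω → ℂ := fun ω => Complex.exp ((-(b * lam) * s * C ω : ℝ) * Complex.I)
    have hg1 : ∀ ω, ‖g ω‖ = 1 := fun ω => Complex.norm_exp_ofReal_mul_I _
    have e1 : ∫ ω, Complex.exp ((s *
        (∑ k ∈ Finset.range (renewalCount Y α ω), U k ω - EM * b) : ℝ) * Complex.I) ∂μ
        = ∫ ω, φ α ^ renewalCount Y α ω * w (renewalCount Y α ω) ∂μ := by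
      rw [hφ, ← integral_exp_random_sum hX hXind hXid hM (hXN α hα) s hw]
      refine integral_congr_ae (ae_of_all _ fun ω => ?_)
      simp only [w]
      rw [← Complex.exp_add, Finset.sum_sub_distrib]
      simp only [Finset.sum_const, Finset.card_range, nsmul_eq_mul]
      congr 1
      push_cast
      ring
    have e2 : ψ α ^ n = ∫ ω, g ω ∂μ := by
      rw [hψ, ← integral_exp_sum_eq_pow hC hCind hCid n]
      refine integral_congr_ae (ae_of_all _ fun ω => ?_)
      simp only [g, C, hs]
      push_cast
      rfl
    have hwm : Measurable fun ω => φ α ^ renewalCount Y α ω * w (renewalCount Y α ω) :=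
      (measurable_from_nat (f := fun m : ℕ => φ α ^ m * w m)).comp hM
    have i1 : Integrable (fun ω => φ α ^ renewalCount Y α ω * w (renewalCount Y α ω)) μ := by
      refine Integrable.of_bound hwm.aestronglyMeasurable 1 (ae_of_all _ fun ω => ?_)
      rw [norm_mul, norm_pow]
      exact mul_le_one₀ (pow_le_one₀ (norm_nonneg _) hφ1) (norm_nonneg _) (hw _)
    have i2 : Integrable g μ :=
      Integrable.of_bound (by fun_prop : Measurable g).aestronglyMeasurable 1
        (ae_of_all _ fun ω => (hg1 ω).le)
    have j1 : Integrable (fun ω => |(renewalCount Y α ω : ℝ) - n|) μ :=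
      (hMi.sub (integrable_const _)).abs
    have j2 : Integrable (fun ω => |(renewalCount Y α ω : ℝ) - EM + lam * C ω|) μ :=
      ((hMi.sub (integrable_const _)).add (hCi.const_mul lam)).abs
    rw [e1, e2, ← integral_const_mul, ← integral_sub i1 (i2.const_mul _)]
    calc ‖∫ ω, (φ α ^ renewalCount Y α ω * w (renewalCount Y α ω) - φ α ^ n * g ω) ∂μ‖
        ≤ ∫ ω, (|(renewalCount Y α ω : ℝ) - n| * ‖φ α - 1‖
            + |b| * s * |(renewalCount Y α ω : ℝ) - EM + lam * C ω|) ∂μ := by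
          refine norm_integral_le_of_norm_le ((j1.mul_const _).add (j2.const_mul _))
            (ae_of_all _ fun ω => ?_)
          set M := renewalCount Y α ω
          -- all factors have norm at most one, so the two replacements are estimated separately
          have e : φ α ^ M * w M - φ α ^ n * g ω
              = (φ α ^ M - φ α ^ n) * w M + φ α ^ n * (w M - g ω) := by ring
          rw [e]
          refine (norm_add_le _ _).trans (add_le_add ?_ ?_)
          · rw [norm_mul]
            exact (mul_le_of_le_one_right (norm_nonneg _) (hw M)).trans
              (norm_pow_sub_pow_le_abs_sub_mul hφ1 _ _)
          · rw [norm_mul, norm_pow]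
            refine (mul_le_of_le_one_left (norm_nonneg _)
              (pow_le_one₀ (norm_nonneg _) hφ1)).trans ?_
            refine (norm_exp_ofReal_mul_I_sub_le _ _).trans (le_of_eq ?_)
            rw [← abs_of_nonneg hs0, ← abs_mul, ← abs_mul, abs_of_nonneg hs0]
            congr 1
            ring
      _ = _ := by
          rw [integral_add (j1.mul_const _) (j2.const_mul _), integral_mul_const,
            integral_const_mul, norm_mul, Complex.norm_real, Real.norm_of_nonneg hα]
          rw [div_mul_eq_mul_div, mul_left_comm, mul_div_cancel_left₀ _ hα0.ne', hs]
          congr 1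
          rw [div_eq_mul_inv]
          ring
  simpa using hdiff.add hprod

/-! ### The vector of claims by development year -/

/-- The vector `z (1{d = 1}, …, 1{d = T})` contributed by a claim of size `z` in development
year `d`. -/
noncomputable def claimVec {T : ℕ} (p : Fin T × ℝ) : EuclideanSpace ℝ (Fin T) :=
  p.2 • WithLp.toLp 2 fun t => ind p.1 t

lemma measurable_claimVec {T : ℕ} : Measurable (claimVec (T := T)) :=
  measurable_from_prod_countable_right fun d =>
    (measurable_id.smul_const (WithLp.toLp 2 fun t => ind d t) :
      Measurable fun z : ℝ => id z • (WithLp.toLp 2 fun t => ind d t : EuclideanSpace ℝ (Fin T)))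

lemma norm_claimVec {T : ℕ} (p : Fin T × ℝ) : ‖claimVec p‖ = |p.2| := by
  have : (WithLp.toLp 2 fun t => ind p.1 t : EuclideanSpace ℝ (Fin T))
      = EuclideanSpace.single p.1 1 := by
    ext t
    simp [ind, eq_comm]
  rw [claimVec, norm_smul, this]
  simp

lemma inner_claimVec {T : ℕ} (p : Fin T × ℝ) (x : EuclideanSpace ℝ (Fin T)) :
    inner ℝ (claimVec p) x = p.2 * ∑ t, x t * ind p.1 t := by
  rw [claimVec, inner_smul_left, PiLp.inner_apply]
  simp

section

variable {Ω : Type*} [MeasurableSpace Ω] {μ : Measure Ω} {T : ℕ} {D : Ω → Fin T} {Z : Ω → ℝ}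

/-- The limiting matrix depends only on the law of the pair. -/
lemma limitCov_congr {Ω' : Type*} [MeasurableSpace Ω'] {P : Measure Ω'} {D₀ : Ω' → Fin T}
    {Z₀ : Ω' → ℝ} (h : IdentDistrib (fun ω => (D ω, Z ω)) (fun ω => (D₀ ω, Z₀ ω)) μ P)
    (lam v : ℝ) : limitCov P D₀ Z₀ lam v = limitCov μ D Z lam v := by
  have hind : ∀ s : Fin T, Measurable fun p : Fin T × ℝ => ind p.1 s := fun s =>
    (measurable_of_countable fun d : Fin T => ind d s).comp measurable_fst
  have h1 : ∀ s, ∫ ω, Z₀ ω * ind (D₀ ω) s ∂P = ∫ ω, Z ω * ind (D ω) s ∂μ := fun s =>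
    ((h.comp (measurable_snd.mul (hind s))).integral_eq).symm
  have h2 : ∀ s t, ∫ ω, Z₀ ω ^ 2 * ind (D₀ ω) s * ind (D₀ ω) t ∂P
      = ∫ ω, Z ω ^ 2 * ind (D ω) s * ind (D ω) t ∂μ := fun s t =>
    ((h.comp (((measurable_snd.pow_const 2).mul (hind s)).mul (hind t))).integral_eq).symm
  ext s t
  simp only [limitCov, Matrix.of_apply, h1, h2]

lemma memLp_claimVec (hD : Measurable D) (hZ : Measurable Z) (hZ2 : MemLp Z 2 μ) :
    MemLp (fun ω => claimVec (D ω, Z ω)) 2 μ :=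
  hZ2.mono (measurable_claimVec.comp (hD.prodMk hZ)).aestronglyMeasurable
    (ae_of_all _ fun _ => (norm_claimVec _).le)

lemma memLp_inner_claimVec (hD : Measurable D) (hZ : Measurable Z) (hZ2 : MemLp Z 2 μ)
    (x : EuclideanSpace ℝ (Fin T)) : MemLp (fun ω => inner ℝ (claimVec (D ω, Z ω)) x) 2 μ :=
  (memLp_claimVec hD hZ hZ2).inner_const x

/-- The quadratic form of the limiting matrix in terms of the projected claim `⟪X, x⟫`. -/
lemma dotProduct_limitCov_mulVec [IsProbabilityMeasure μ] (hD : Measurable D) (hZ : Measurable Z)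
    (hZ2 : MemLp Z 2 μ) (lam v : ℝ) (x : EuclideanSpace ℝ (Fin T)) :
    x.ofLp ⬝ᵥ (limitCov μ D Z lam v).mulVec x.ofLp
      = lam * Var[fun ω => inner ℝ (claimVec (D ω, Z ω)) x; μ]
        + lam ^ 3 * v * (∫ ω, inner ℝ (claimVec (D ω, Z ω)) x ∂μ) ^ 2 := by
  have hind : ∀ s : Fin T, Measurable fun ω => ind (D ω) s := fun s =>
    (measurable_of_countable fun d : Fin T => ind d s).comp hD
  have hle : ∀ (d s : Fin T), |ind d s| ≤ 1 := fun d s => by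
    rw [ind]; split_ifs <;> simp
  have hi1 : ∀ s, Integrable (fun ω => Z ω * ind (D ω) s) μ := fun s =>
    (hZ2.integrable one_le_two).mul_bdd (c := 1) (hind s).aestronglyMeasurable
      (ae_of_all _ fun ω => hle _ _)
  have hi2 : ∀ s t, Integrable (fun ω => Z ω ^ 2 * ind (D ω) s * ind (D ω) t) μ := fun s t =>
    (hZ2.integrable_sq.mul_bdd (c := 1) (hind s).aestronglyMeasurable
      (ae_of_all _ fun ω => hle _ _)).mul_bdd (c := 1) (hind t).aestronglyMeasurable
      (ae_of_all _ fun ω => hle _ _)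
  have e1 : ∫ ω, inner ℝ (claimVec (D ω, Z ω)) x ∂μ
      = ∑ s, x s * ∫ ω, Z ω * ind (D ω) s ∂μ := by
    simp_rw [inner_claimVec, Finset.mul_sum, ← integral_const_mul]
    rw [← integral_finsetSum _ fun s _ => (hi1 s).const_mul _]
    refine integral_congr_ae (ae_of_all _ fun ω => Finset.sum_congr rfl fun s _ => ?_)
    ring
  have e2 : ∫ ω, inner ℝ (claimVec (D ω, Z ω)) x ^ 2 ∂μ
      = ∑ s, ∑ t, x s * x t * ∫ ω, Z ω ^ 2 * ind (D ω) s * ind (D ω) t ∂μ := by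
    have e : ∀ ω, inner ℝ (claimVec (D ω, Z ω)) x ^ 2
        = ∑ s, ∑ t, x s * x t * (Z ω ^ 2 * ind (D ω) s * ind (D ω) t) := fun ω => by
      rw [inner_claimVec, mul_pow, sq (∑ t, _), Finset.sum_mul_sum, Finset.mul_sum]
      refine Finset.sum_congr rfl fun s _ => ?_
      rw [Finset.mul_sum]
      refine Finset.sum_congr rfl fun t _ => ?_
      ring
    simp_rw [e]
    rw [integral_finsetSum _ fun s _ =>
      integrable_finsetSum _ fun t _ => (hi2 s t).const_mul (x s * x t)]
    refine Finset.sum_congr rfl fun s _ => ?_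
    rw [integral_finsetSum _ fun t _ => (hi2 s t).const_mul (x s * x t)]
    exact Finset.sum_congr rfl fun t _ => integral_const_mul _ _
  rw [variance_eq_sub (memLp_inner_claimVec hD hZ hZ2 x)]
  simp only [Pi.pow_apply]
  rw [e2, e1]
  set a : Fin T → ℝ := fun s => ∫ ω, Z ω * ind (D ω) s ∂μ with ha
  set B : Fin T → Fin T → ℝ := fun s t => ∫ ω, Z ω ^ 2 * ind (D ω) s * ind (D ω) t ∂μ
  have e3 : x.ofLp ⬝ᵥ (limitCov μ D Z lam v).mulVec x.ofLp
      = lam * (∑ s, ∑ t, x s * x t * B s t)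
        + lam * (lam ^ 2 * v - 1) * ((∑ s, x s * a s) * ∑ t, x t * a t) := by
    rw [Finset.sum_mul_sum, Finset.mul_sum, Finset.mul_sum, ← Finset.sum_add_distrib]
    refine Finset.sum_congr rfl fun s _ => ?_
    rw [Matrix.mulVec, dotProduct, Finset.mul_sum, Finset.mul_sum, Finset.mul_sum,
      ← Finset.sum_add_distrib]
    refine Finset.sum_congr rfl fun t _ => ?_
    simp only [limitCov, Matrix.of_apply, a, B]
    ring
  rw [e3]
  ring

lemma posSemidef_limitCov [IsProbabilityMeasure μ] (hD : Measurable D) (hZ : Measurable Z)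
    (hZ2 : MemLp Z 2 μ) {lam v : ℝ} (hlam : 0 ≤ lam) (hv : 0 ≤ v) :
    (limitCov μ D Z lam v).PosSemidef := by
  refine Matrix.PosSemidef.of_dotProduct_mulVec_nonneg ?_ fun x => ?_
  · ext s t
    simp only [Matrix.conjTranspose_apply, limitCov, Matrix.of_apply, star_trivial]
    simp only [mul_right_comm _ (ind _ t) (ind _ s)]
    ring
  · have h := dotProduct_limitCov_mulVec hD hZ hZ2 lam v (WithLp.toLp 2 x)
    rw [star_trivial, h]
    have := variance_nonneg (fun ω => inner ℝ (claimVec (D ω, Z ω)) (WithLp.toLp 2 x)) μ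
    positivity

end

end ChainLadder

theorem mainTheorem5 {Ω Ω' : Type*} [MeasurableSpace Ω] [MeasurableSpace Ω']
    (μ : Measure Ω) [IsProbabilityMeasure μ] (P : Measure Ω') [IsProbabilityMeasure P]
    (T : ℕ)
    -- the generic pair `(D, Z)`
    (D₀ : Ω' → Fin T) (Z₀ : Ω' → ℝ) (hZ₀ : MemLp Z₀ 2 P)
    -- development years and claim sizes: for each accident year an i.i.d. sequence of pairs
    (D : Fin T → ℕ → Ω → Fin T) (Z : Fin T → ℕ → Ω → ℝ)
    (hDm : ∀ j k, Measurable (D j k)) (hZm : ∀ j k, Measurable (Z j k))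
    (hDZ_indep : ∀ j, iIndepFun (fun k ω => (D j k ω, Z j k ω)) μ)
    (hDZ_law : ∀ j k,
      IdentDistrib (fun ω => (D j k ω, Z j k ω)) (fun ω => (D₀ ω, Z₀ ω)) μ P)
    -- inter-arrival times: for each accident year an i.i.d. nonnegative sequence
    (lam : Fin T → ℝ) (hlam : ∀ j, 0 < lam j)
    (Y : Fin T → ℕ → Ω → ℝ) (hYm : ∀ j k, Measurable (Y j k))
    (hY_nonneg : ∀ j k, ∀ᵐ ω ∂μ, 0 ≤ Y j k ω)
    (hY_indep : ∀ j, iIndepFun (Y j) μ)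
    (hY_law : ∀ j k, IdentDistrib (Y j k) (Y j 0) μ μ)
    (hY_sq : ∀ j, MemLp (Y j 0) 2 μ)
    (hY_mean : ∀ j, ∫ ω, Y j 0 ω ∂μ = 1 / lam j)
    -- the counting variable is independent of the claims sequence
    (hMDZ : ∀ (j : Fin T) (α : ℝ), 0 ≤ α →
      IndepFun (ChainLadder.renewalCount (Y j) α) (fun ω (k : ℕ) => (D j k ω, Z j k ω)) μ)
    (j : Fin T) :
    (∀ α : ℝ, 0 ≤ α → Integrable
      (ChainLadder.compoundSum (ChainLadder.renewalCount (Y j) α) (D j) (Z j)) μ) ∧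
    (ChainLadder.limitCov P D₀ Z₀ (lam j) (Var[Y j 0; μ])).PosSemidef ∧
    TendstoInDistribution
      (fun (α : ℝ) ω => α ^ (-(1 / 2) : ℝ) •
        (ChainLadder.compoundSum (ChainLadder.renewalCount (Y j) α) (D j) (Z j) ω
          - ∫ ω', ChainLadder.compoundSum (ChainLadder.renewalCount (Y j) α) (D j) (Z j) ω' ∂μ))
      atTop (id : EuclideanSpace ℝ (Fin T) → EuclideanSpace ℝ (Fin T))
      (fun _ => μ)
      (multivariateGaussian 0 (ChainLadder.limitCov P D₀ Z₀ (lam j) (Var[Y j 0; μ]))) := by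
  have hY : ChainLadder.IsRenewalSequence μ (Y j) :=
    ⟨hYm j, hY_nonneg j, hY_indep j, hY_law j, hY_sq j, by
      rw [hY_mean j]; exact one_div_pos.2 (hlam j)⟩
  rw [ChainLadder.limitCov_congr (hDZ_law j 0)]
  have hpair : ∀ k, IdentDistrib (fun ω => (D j k ω, Z j k ω)) (fun ω => (D j 0 ω, Z j 0 ω)) μ μ :=
    fun k => (hDZ_law j k).trans (hDZ_law j 0).symm
  have hZ2 : MemLp (Z j 0) 2 μ := ((hDZ_law j 0).comp measurable_snd).memLp_iff.2 hZ₀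
  set X : ℕ → Ω → EuclideanSpace ℝ (Fin T) := fun k ω => ChainLadder.claimVec (D j k ω, Z j k ω)
    with hXdef
  have hX : ∀ k, Measurable (X k) := fun k =>
    ChainLadder.measurable_claimVec.comp ((hDm j k).prodMk (hZm j k))
  have hXL : MemLp (X 0) 2 μ := ChainLadder.memLp_claimVec (hDm j 0) (hZm j 0) hZ2
  have hXi : Integrable (X 0) μ := hXL.integrable one_le_two
  have hXid : ∀ k, IdentDistrib (X k) (X 0) μ μ := fun k =>
    (hpair k).comp ChainLadder.measurable_claimVec
  have hXN : ∀ α : ℝ, 0 ≤ α →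
      IndepFun (ChainLadder.renewalCount (Y j) α) (fun ω k => X k ω) μ := fun α hα =>
    (hMDZ j α hα).comp (φ := id)
      (ψ := fun (p : ℕ → Fin T × ℝ) k => ChainLadder.claimVec (p k)) measurable_id
      (measurable_pi_lambda _ fun k =>
        ChainLadder.measurable_claimVec.comp (measurable_pi_apply k))
  have hS : ∀ α, ChainLadder.compoundSum (ChainLadder.renewalCount (Y j) α) (D j) (Z j)
      = fun ω => ∑ k ∈ Finset.range (ChainLadder.renewalCount (Y j) α ω), X k ω := fun _ => rfl
  have hmean : ∀ α : ℝ, 0 ≤ α → _ := fun α hα =>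
    ChainLadder.integrable_and_integral_random_sum hX hXi hXid
      (ChainLadder.measurable_renewalCount (hYm j) α) (hY.integrable_renewalCount hα) (hXN α hα)
  have hpsd := ChainLadder.posSemidef_limitCov (hDm j 0) (hZm j 0) hZ2 (hlam j).le
    (variance_nonneg (Y j 0) μ)
  refine ⟨fun α hα => by rw [hS]; exact (hmean α hα).1, hpsd, ?_⟩
  have hSm : ∀ α, Measurable
      (ChainLadder.compoundSum (ChainLadder.renewalCount (Y j) α) (D j) (Z j)) := fun α => by
    have hF : Measurable fun p : ℕ × (ℕ → EuclideanSpace ℝ (Fin T)) =>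
        ∑ k ∈ Finset.range p.1, p.2 k :=
      measurable_from_prod_countable_right fun n =>
        Finset.measurable_fun_sum (Finset.range n) fun k _ => measurable_pi_apply k
    rw [hS]
    exact hF.comp ((ChainLadder.measurable_renewalCount (hYm j) α).prodMk
      (measurable_pi_lambda _ hX))
  have hVm : ∀ α : ℝ, AEMeasurable (fun ω => α ^ (-(1 / 2) : ℝ) •
      (ChainLadder.compoundSum (ChainLadder.renewalCount (Y j) α) (D j) (Z j) ω
        - ∫ ω', ChainLadder.compoundSum (ChainLadder.renewalCount (Y j) α) (D j) (Z j) ω' ∂μ)) μ :=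
    fun α => by
      have := hSm α
      fun_prop
  -- convergence of the characteristic functions, by projection to the real line
  have hchar : ∀ x : EuclideanSpace ℝ (Fin T), Tendsto (fun α : ℝ => charFun (μ.map fun ω =>
      α ^ (-(1 / 2) : ℝ) •
      (ChainLadder.compoundSum (ChainLadder.renewalCount (Y j) α) (D j) (Z j) ω
        - ∫ ω', ChainLadder.compoundSum (ChainLadder.renewalCount (Y j) α) (D j) (Z j) ω' ∂μ)) x)
      atTop (𝓝 (charFun (multivariateGaussian 0
        (ChainLadder.limitCov μ (D j 0) (Z j 0) (lam j) (Var[Y j 0; μ]))) x)) := by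
    intro x
    have hu : Measurable fun y : EuclideanSpace ℝ (Fin T) => inner ℝ y x := by fun_prop
    have h := hY.tendsto_integral_exp_compound (hlam j) (hY_mean j)
      (U := fun k ω => inner ℝ (X k ω) x) (fun k => hu.comp (hX k))
      (ChainLadder.memLp_inner_claimVec (hDm j 0) (hZm j 0) hZ2 x)
      ((hDZ_indep j).comp (fun _ p => inner ℝ (ChainLadder.claimVec p) x)
        fun _ => hu.comp ChainLadder.measurable_claimVec)
      (fun k => (hXid k).comp hu)
      (fun α hα => (hXN α hα).comp (φ := id)
        (ψ := fun (y : ℕ → EuclideanSpace ℝ (Fin T)) k => inner ℝ (y k) x) measurable_id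
        (measurable_pi_lambda _ fun k => hu.comp (measurable_pi_apply k)))
    rw [charFun_multivariateGaussian hpsd,
      ChainLadder.dotProduct_limitCov_mulVec (hDm j 0) (hZm j 0) hZ2]
    have hlim : Complex.exp (((inner ℝ x (0 : EuclideanSpace ℝ (Fin T)) : ℝ) : ℂ) * Complex.I
        - ((lam j * Var[fun ω => inner ℝ (ChainLadder.claimVec (D j 0 ω, Z j 0 ω)) x; μ]
          + lam j ^ 3 * Var[Y j 0; μ]
            * (∫ ω, inner ℝ (ChainLadder.claimVec (D j 0 ω, Z j 0 ω)) x ∂μ) ^ 2 : ℝ) : ℂ) / 2)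
        = Complex.exp (-((lam j * Var[fun ω => inner ℝ (X 0 ω) x; μ]
          + lam j ^ 3 * Var[Y j 0; μ] * (∫ ω, inner ℝ (X 0 ω) x ∂μ) ^ 2) / 2 : ℝ)) := by
      rw [inner_zero_right]
      congr 1
      push_cast
      ring
    have hinner : inner ℝ (∫ ω, X 0 ω ∂μ) x = ∫ ω, inner ℝ (X 0 ω) x ∂μ := by
      rw [real_inner_comm, ← integral_inner hXi]
      exact integral_congr_ae (ae_of_all _ fun ω => real_inner_comm _ _)
    rw [hlim]
    refine h.congr' ?_
    filter_upwards [eventually_ge_atTop 0] with α hα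
    have hpow : α ^ (-(1 / 2) : ℝ) = (√α)⁻¹ := by
      rw [Real.rpow_neg hα, ← Real.sqrt_eq_rpow]
    rw [charFun_apply, integral_map (hVm α) (by fun_prop)]
    refine integral_congr_ae (ae_of_all _ fun ω => ?_)
    simp only [hS]
    rw [(hmean α hα).2, hpow, real_inner_smul_left, inner_sub_left, sum_inner,
      real_inner_smul_left, hinner]
  refine ⟨hVm, aemeasurable_id, ?_⟩
  -- Lévy's theorem is available along sequences, which determine limits at infinity
  refine tendsto_of_seq_tendsto fun a ha => ?_
  refine ProbabilityMeasure.tendsto_iff_tendsto_charFun.2 fun x => ?_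
  simp only [ProbabilityMeasure.coe_mk, Measure.map_id]
  exact (hchar x).comp ha
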